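/- Let $\alpha,\beta>0$, $\theta\in(0,1)$, $I=[x_\ell,x_r]$ with $x_\ell<x_r$, and let $\|\cdot\|_{k+\theta}$ be the norm of $C^{k+\theta}(I)$, i.e. $\|u\|_{k+\theta}=\sum_{j\le k}\max_I|u^{(j)}|+\sup_{x\ne y\in I}|u^{(k)}(x)-u^{(k)}(y)|/|x-y|^{\theta}$. Let $f\in C^{4+\theta}(I)$, $f>0$ on $I$, solve the minimal surface equation $ff''=1+f'^2$ on $I$, and let $f$ be stable: there is $\chi\in C^{2+\theta}(I)$ with $\chi>0$ and $\chi''-\frac{2f'}{f}\chi'+\frac{f''}{f}\chi\le 0$ on $I$. Fix such a $\chi$ and assume $\frac1{f^2}<\frac{\alpha}{\beta}$ on $I$. For a function $u>0$ on $I$ put $$M[u]=\frac{u''}{2(1+u'^2)^{3/2}}-\frac1{2u\sqrt{1+u'^2}},$$ $$E[u,H]=H''+u'\Big(\frac1u-\frac{u''}{1+u'^2}\Big)H'+2H^3(1+u'^2)+2\frac{u''}{u}H-\frac{2\alpha}{\beta}(1+u'^2)H,$$ and put $$\mathcal L_1[\varphi]=\varphi''+2\Big(\frac{\chi'}{\chi}-\frac{f'}{f}\Big)\varphi'+\Big(\frac{\chi''}{\chi}-\frac{2f'\chi'}{f\chi}+\frac{f''}{f}\Big)\varphi,\qquad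 \mathcal L_2[H]=H''+\frac{2f''}{f}H-\frac{2\alpha}{\beta}(1+f'^2)H,$$ $$\Phi_1(\varphi,H)=\frac{2(1+f'^2)^{3/2}}{\chi}H+\chi^{-1}\Psi_1(\varphi\chi),\qquad \Psi_1(\psi)=\psi''-\frac{2f'}{f}\psi'+\frac{f''}{f}\psi-2(1+f'^2)^{3/2}M[f+\psi],$$ $$\Phi_2(\varphi,H)=\mathcal L_2[H]-E[f+\varphi\chi,H].$$ Then for every $\delta>0$ there is $\varepsilon_0>0$ such that for every $\varepsilon\in(0,\varepsilon_0]$ and all $\varphi_0,H_0\in C^{2+\theta}(I)$ with $\|\varphi_0\|_{2+\theta}<\varepsilon$ and $\|H_0\|_{2+\theta}<\varepsilon$ the following holds. (a) The scheme $$\mathcal L_2[H_{k+1}]=\Phi_2(\varphi_k,H_k),\quad H_{k+1}(x_\ell)=H_{k+1}(x_r)=0,$$ $$\mathcal L_1[\varphi_{k+1}]=\Phi_1(\varphi_k,H_{k+1}),\quad \varphi_{k+1}(x_\ell)=\varphi_{k+1}(x_r)=0\qquad(k=0,1,2,\dots)$$ is well defined: at each step each linear problem has exactly one solution in $C^{2+\theta}(I)$.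 Moreover $\|\varphi_k\|_{2+\theta}\le\varepsilon$ and $\|H_k\|_{2+\theta}\le\varepsilon$ for all $k$. (b) $\varphi_k$ and $H_k$ converge in $C^{2+\theta}(I)$ to functions $\varphi,\widetilde H\in C^{2+\theta}(I)$ with norms less than $\varepsilon$ which solve $\mathcal L_1[\varphi]=\Phi_1(\varphi,\widetilde H)$ and $\mathcal L_2[\widetilde H]=\Phi_2(\varphi,\widetilde H)$ on $I$ and vanish at $x_\ell$ and $x_r$. (c) The function $\tilde f=f+\varphi\chi$ is positive, belongs to $C^{4+\theta}(I)$, has the same boundary values as $f$, satisfies $\|\tilde f-f\|_{4+\theta}<\delta$, and the pair $(\tilde f,\widetilde H)$ solves on $I$ the rotationally symmetric mean curvature equation $$\tilde f''=2\widetilde H(1+\tilde f'^2)^{3/2}+\frac{1+\tilde f'^2}{\tilde f}$$ and the Euler–Lagrange equation $E[\tilde f,\widetilde H]=0$ of the Nitsche functional, with $\widetilde H(x_\ell)=\widetilde H(x_r)=0$. -/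

import Mathlib

open Set Filter Topology
open scoped NNReal

namespace Nitsche

noncomputable section

/-- The first derivative of `u` on the interval `I` (one-sided at the endpoints). -/
def d1 (I : Set ℝ) (u : ℝ → ℝ) (x : ℝ) : ℝ := iteratedDerivWithin 1 u I x

/-- The second derivative of `u` on the interval `I` (one-sided at the endpoints). -/
def d2 (I : Set ℝ) (u : ℝ → ℝ) (x : ℝ) : ℝ := iteratedDerivWithin 2 u I x

/-- `u` belongs to the Hölder space of order `k + θ` on `I`. -/
def MemCHolder (k : ℕ) (θ : ℝ≥0) (I : Set ℝ) (u : ℝ → ℝ) : Prop :=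
  ContDiffOn ℝ k u I ∧ ∃ C : ℝ≥0, HolderOnWith C θ (iteratedDerivWithin k u I) I

/-- The sup norm of `g` on `I`. -/
def supNorm (I : Set ℝ) (g : ℝ → ℝ) : ℝ := sSup ((fun x => |g x|) '' I)

/-- The Hölder seminorm of exponent `θ` of `g` on `I`. -/
def holderSeminorm (θ : ℝ≥0) (I : Set ℝ) (g : ℝ → ℝ) : ℝ :=
  sSup {r : ℝ | ∃ x ∈ I, ∃ y ∈ I, x ≠ y ∧ r = |g x - g y| / |x - y| ^ (θ : ℝ)}

/-- The norm of the Hölder space of order `k + θ` on `I`: the sum of the sup norms of the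
derivatives of order at most `k` and of the Hölder seminorm of the `k`-th derivative. It is
meaningful for functions satisfying `MemCHolder k θ I` and is only used for those. -/
def cHolderNorm (k : ℕ) (θ : ℝ≥0) (I : Set ℝ) (u : ℝ → ℝ) : ℝ :=
  ∑ j ∈ Finset.range (k + 1), supNorm I (iteratedDerivWithin j u I)
    + holderSeminorm θ I (iteratedDerivWithin k u I)

/-- `f` solves the minimal surface equation `f f'' = 1 + f'^2` for rotational surfaces. -/
def MinimalSurfaceEq (I : Set ℝ) (f : ℝ → ℝ) : Prop :=
  ∀ x ∈ I, f x * d2 I f x = 1 + d1 I f x ^ 2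

/-- The operator `ψ'' - (2 f'/f) ψ' + (f''/f) ψ`: the linearised minimal surface operator. -/
def jacobiOp (I : Set ℝ) (f ψ : ℝ → ℝ) (x : ℝ) : ℝ :=
  d2 I ψ x - 2 * d1 I f x / f x * d1 I ψ x + d2 I f x / f x * ψ x

/-- `χ` is a stability function for `f`. -/
def IsStabilityFunction (θ : ℝ≥0) (I : Set ℝ) (f χ : ℝ → ℝ) : Prop :=
  MemCHolder 2 θ I χ ∧ (∀ x ∈ I, 0 < χ x) ∧ ∀ x ∈ I, jacobiOp I f χ x ≤ 0

/-- The mean curvature along the meridian `u` of the surface obtained by rotating `u`. -/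
def meanCurv (I : Set ℝ) (u : ℝ → ℝ) (x : ℝ) : ℝ :=
  d2 I u x / (2 * (1 + d1 I u x ^ 2) ^ (3 / 2 : ℝ))
    - 1 / (2 * u x * Real.sqrt (1 + d1 I u x ^ 2))

/-- `u` and `H` satisfy the rotationally symmetric mean curvature equation
`u'' = 2 H (1 + u'^2)^(3/2) + (1 + u'^2) / u`. -/
def MeanCurvatureEq (I : Set ℝ) (u H : ℝ → ℝ) : Prop :=
  ∀ x ∈ I, d2 I u x
    = 2 * H x * (1 + d1 I u x ^ 2) ^ (3 / 2 : ℝ) + (1 + d1 I u x ^ 2) / u x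

/-- The left-hand side of the rotationally symmetric Euler-Lagrange equation of the functional
with area weight `α` and weight `β` of the squared mean curvature. -/
def eulerLagrange (α β : ℝ) (I : Set ℝ) (u H : ℝ → ℝ) (x : ℝ) : ℝ :=
  d2 I H x
    + d1 I u x * (1 / u x - d2 I u x / (1 + d1 I u x ^ 2)) * d1 I H x
    + 2 * H x ^ 3 * (1 + d1 I u x ^ 2)
    + 2 * (d2 I u x / u x) * H x
    - 2 * α / β * (1 + d1 I u x ^ 2) * H x

/-- `u` and `H` satisfy the rotationally symmetric Euler-Lagrange equation. -/
def EulerLagrangeEq (α β : ℝ) (I : Set ℝ) (u H : ℝ → ℝ) : Prop :=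
  ∀ x ∈ I, eulerLagrange α β I u H x = 0

/-- The perturbed meridian `f + φ χ`. -/
def perturbed (f χ φ : ℝ → ℝ) (x : ℝ) : ℝ := f x + φ x * χ x

/-- The linear operator for `φ`. -/
def opL1 (I : Set ℝ) (f χ φ : ℝ → ℝ) (x : ℝ) : ℝ :=
  d2 I φ x
    + 2 * (d1 I χ x / χ x - d1 I f x / f x) * d1 I φ x
    + (d2 I χ x / χ x - 2 * d1 I f x * d1 I χ x / (f x * χ x) + d2 I f x / f x) * φ x

/-- The linear operator for the mean curvature. -/
def opL2 (α β : ℝ) (I : Set ℝ) (f H : ℝ → ℝ) (x : ℝ) : ℝ :=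
  d2 I H x + 2 * d2 I f x / f x * H x - 2 * α / β * (1 + d1 I f x ^ 2) * H x

/-- The super-linear part in `ψ` of the mean curvature operator along `f + ψ`: what remains of
`-2 (1 + f'^2)^(3/2)` times the mean curvature after its linear part has been removed
(the constant part vanishes when `f` solves the minimal surface equation). -/
def remainder1 (I : Set ℝ) (f ψ : ℝ → ℝ) (x : ℝ) : ℝ :=
  jacobiOp I f ψ x
    - 2 * (1 + d1 I f x ^ 2) ^ (3 / 2 : ℝ) * meanCurv I (fun y => f y + ψ y) x

/-- The non-linear right-hand side of the equation for `φ`. -/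
def rhs1 (I : Set ℝ) (f χ φ H : ℝ → ℝ) (x : ℝ) : ℝ :=
  2 * (1 + d1 I f x ^ 2) ^ (3 / 2 : ℝ) / χ x * H x
    + (χ x)⁻¹ * remainder1 I f (fun y => φ y * χ y) x

/-- The non-linear right-hand side of the equation for the mean curvature: the difference between
the linear operator and the full Euler-Lagrange expression along `f + φ χ`. -/
def rhs2 (α β : ℝ) (I : Set ℝ) (f χ φ H : ℝ → ℝ) (x : ℝ) : ℝ :=
  opL2 α β I f H x - eulerLagrange α β I (perturbed f χ φ) H x

/-- `u` is of class `2 + θ` on `[xl, xr]`, solves `L u = g` there, and vanishes at `xl`, `xr`. -/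
def DirichletSol (θ : ℝ≥0) (xl xr : ℝ) (L : (ℝ → ℝ) → ℝ → ℝ) (g u : ℝ → ℝ) : Prop :=
  MemCHolder 2 θ (Icc xl xr) u ∧ (∀ x ∈ Icc xl xr, L u x = g x) ∧ u xl = 0 ∧ u xr = 0

/-- `u` is the unique solution (as a function on `[xl, xr]`) of the homogeneous Dirichlet
problem. -/
def UniqueDirichletSol (θ : ℝ≥0) (xl xr : ℝ) (L : (ℝ → ℝ) → ℝ → ℝ) (g u : ℝ → ℝ) : Prop :=
  DirichletSol θ xl xr L g u ∧
    ∀ v, DirichletSol θ xl xr L g v → EqOn v u (Icc xl xr)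

/-- The coupled successive approximation: from `(φ k, H k)` one first gets `H (k+1)` and then,
already using `H (k+1)`, one gets `φ (k+1)`; each is the unique solution of a linear problem. -/
def IsSuccessiveApprox (θ : ℝ≥0) (α β xl xr : ℝ) (f χ : ℝ → ℝ) (φ H : ℕ → ℝ → ℝ) : Prop :=
  ∀ k,
    UniqueDirichletSol θ xl xr (opL2 α β (Icc xl xr) f)
      (rhs2 α β (Icc xl xr) f χ (φ k) (H k)) (H (k + 1)) ∧
    UniqueDirichletSol θ xl xr (opL1 (Icc xl xr) f χ)
      (rhs1 (Icc xl xr) f χ (φ k) (H (k + 1))) (φ (k + 1))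

/-- Convergence in the norm of order `2 + θ`. -/
def TendstoC2Holder (θ : ℝ≥0) (I : Set ℝ) (u : ℕ → ℝ → ℝ) (v : ℝ → ℝ) : Prop :=
  Tendsto (fun k => cHolderNorm 2 θ I (fun x => u k x - v x)) atTop (𝓝 0)

end

end Nitsche

/-! Since `f` solves the minimal surface equation, it has zero mean curvature, and the pair (0, 0)
solves the coupled problem. The proof shows that each step of the scheme pulls a small pair towards
(0, 0) by as small a factor as desired. The iterates thus stay in the ball and converge to (0, 0),
and the perturbed meridian is `f` itself. The bounds in part (c) are then immediate, with no
bootstrapping to order 4 + θ. No estimate between successive iterates is needed, only the decay of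
their norms.

The contraction has two sources. The linear sources are the Dirichlet problems. Both have the form
u'' + p u' + q u with q ≤ 0: for `opL1` this is stability, since q is the Jacobi operator of `χ`
divided by `χ`; for `opL2` the minimal surface equation turns q into 2(1 + f'^2)(1/f^2 - α/β). The
sign gives uniqueness (`eq_zero_of_dirichletOp_eq_zero`), shooting with the initial value problem
gives existence (`dirichletOp_bijective`), and the open mapping theorem gives a bounded inverse.

The nonlinear source is that `remainder1` and `rhs2` vanish to second order at 0. The Hölder space
is a Banach algebra, so these terms are Fréchet differentiable at 0, being built from products,
inverses and a square root. Point evaluations separate its elements, so the derivative vanishes as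
soon as it does so pointwise, which is calculus with real numbers (`exists_norm_le_of_pointwise`).
The term linear in the curvature on the right-hand side of the equation for φ is harmless because
the new curvature, already superlinearly small, is inserted. `exists_approximation_step` combines
the two sources. -/

namespace Nitsche

noncomputable section

/-! ### The Hölder space as a complete normed algebra. -/

/-- The continuous functions on `[a, b]` that are Hölder continuous of exponent `θ`. -/
def holderSubalgebra (θ : ℝ≥0) (a b : ℝ) : Subalgebra ℝ C(Icc a b, ℝ) where
  carrier := {u | ∃ C : ℝ, ∀ x y : Icc a b, |u x - u y| ≤ C * |(x : ℝ) - y| ^ (θ : ℝ)}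
  mul_mem' := by
    rintro u v ⟨C, hC⟩ ⟨D, hD⟩
    refine ⟨‖u‖ * D + ‖v‖ * C, fun x y => ?_⟩
    have h : (u * v) x - (u * v) y = u x * (v x - v y) + v y * (u x - u y) := by
      simp only [ContinuousMap.mul_apply]; ring
    rw [h, add_mul]
    refine (abs_add_le _ _).trans (add_le_add ?_ ?_)
    · rw [abs_mul, mul_assoc]
      exact mul_le_mul (u.norm_coe_le_norm x) (hD x y) (abs_nonneg _) (norm_nonneg _)
    · rw [abs_mul, mul_assoc]
      exact mul_le_mul (v.norm_coe_le_norm y) (hC x y) (abs_nonneg _) (norm_nonneg _)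
  add_mem' := by
    rintro u v ⟨C, hC⟩ ⟨D, hD⟩
    refine ⟨C + D, fun x y => ?_⟩
    have h : (u + v) x - (u + v) y = (u x - u y) + (v x - v y) := by
      simp only [ContinuousMap.add_apply]; ring
    rw [h, add_mul]
    exact (abs_add_le _ _).trans (add_le_add (hC x y) (hD x y))
  algebraMap_mem' := by
    intro r
    exact ⟨0, fun x y => by simp⟩

/-- The Hölder space of exponent `θ` on `[a, b]`, with its own norm. -/
def HolderAlg (θ : ℝ≥0) (a b : ℝ) : Type := holderSubalgebra θ a b

namespace HolderAlg

variable {θ : ℝ≥0} {a b : ℝ}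

instance : CommRing (HolderAlg θ a b) := inferInstanceAs (CommRing (holderSubalgebra θ a b))

instance : Algebra ℝ (HolderAlg θ a b) := inferInstanceAs (Algebra ℝ (holderSubalgebra θ a b))

/-- The underlying continuous function. -/
def toCont (u : HolderAlg θ a b) : C(Icc a b, ℝ) := u.1

instance : CoeFun (HolderAlg θ a b) fun _ => Icc a b → ℝ := ⟨fun u => u.toCont⟩

@[ext] theorem ext {u v : HolderAlg θ a b} (h : ∀ x, u x = v x) : u = v :=
  Subtype.ext (ContinuousMap.ext h)

@[simp] theorem add_apply (u v : HolderAlg θ a b) (x : Icc a b) : (u + v) x = u x + v x := rfl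
@[simp] theorem sub_apply (u v : HolderAlg θ a b) (x : Icc a b) : (u - v) x = u x - v x := rfl
@[simp] theorem neg_apply (u : HolderAlg θ a b) (x : Icc a b) : (-u) x = -u x := rfl
@[simp] theorem mul_apply (u v : HolderAlg θ a b) (x : Icc a b) : (u * v) x = u x * v x := rfl
@[simp] theorem smul_apply (c : ℝ) (u : HolderAlg θ a b) (x : Icc a b) :
    (c • u) x = c * u x := rfl
@[simp] theorem zero_apply (x : Icc a b) : (0 : HolderAlg θ a b) x = 0 := rfl
@[simp] theorem one_apply (x : Icc a b) : (1 : HolderAlg θ a b) x = 1 := rfl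
@[simp] theorem pow_apply (u : HolderAlg θ a b) (n : ℕ) (x : Icc a b) :
    (u ^ n) x = u x ^ n := rfl

theorem continuous_coe (u : HolderAlg θ a b) : Continuous u := u.toCont.continuous

/-- The best Hölder constant. -/
def holderConst (u : HolderAlg θ a b) : ℝ :=
  sSup {r : ℝ | ∃ x y : Icc a b, x ≠ y ∧ r = |u x - u y| / |(x : ℝ) - y| ^ (θ : ℝ)}

theorem rpow_dist_pos {x y : Icc a b} (h : x ≠ y) : 0 < |(x : ℝ) - y| ^ (θ : ℝ) :=
  Real.rpow_pos_of_pos (abs_pos.2 (sub_ne_zero.2 fun h' => h (Subtype.ext h'))) _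

theorem bddAbove_quotients (u : HolderAlg θ a b) :
    BddAbove {r : ℝ | ∃ x y : Icc a b, x ≠ y ∧ r = |u x - u y| / |(x : ℝ) - y| ^ (θ : ℝ)} := by
  obtain ⟨C, hC⟩ := u.2
  refine ⟨C, ?_⟩
  rintro r ⟨x, y, hxy, rfl⟩
  exact (div_le_iff₀ (rpow_dist_pos hxy)).2 (hC x y)

theorem holderConst_nonneg (u : HolderAlg θ a b) : 0 ≤ u.holderConst := by
  refine Real.sSup_nonneg ?_
  rintro r ⟨x, y, hxy, rfl⟩
  positivity

theorem abs_sub_le_holderConst (u : HolderAlg θ a b) (x y : Icc a b) :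
    |u x - u y| ≤ u.holderConst * |(x : ℝ) - y| ^ (θ : ℝ) := by
  rcases eq_or_ne x y with rfl | hxy
  · simpa using mul_nonneg u.holderConst_nonneg (Real.rpow_nonneg le_rfl _)
  · exact (div_le_iff₀ (rpow_dist_pos hxy)).1 (le_csSup u.bddAbove_quotients ⟨x, y, hxy, rfl⟩)

theorem holderConst_le {u : HolderAlg θ a b} {C : ℝ} (hC : 0 ≤ C)
    (h : ∀ x y : Icc a b, |u x - u y| ≤ C * |(x : ℝ) - y| ^ (θ : ℝ)) : u.holderConst ≤ C := by
  refine Real.sSup_le ?_ hC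
  rintro r ⟨x, y, hxy, rfl⟩
  exact (div_le_iff₀ (rpow_dist_pos hxy)).2 (h x y)

/-- The norm of the Hölder space as a ring norm. -/
def ringNorm (θ : ℝ≥0) (a b : ℝ) : RingNorm (HolderAlg θ a b) where
  toFun u := ‖u.toCont‖ + u.holderConst
  map_zero' := by
    have h1 : (0 : HolderAlg θ a b).holderConst = 0 :=
      le_antisymm (holderConst_le le_rfl fun x y => by simp) (holderConst_nonneg _)
    have h2 : (0 : HolderAlg θ a b).toCont = 0 := rfl
    simp [h1, h2]
  add_le' u v := by
    have h1 : (u + v).holderConst ≤ u.holderConst + v.holderConst := by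
      refine holderConst_le (add_nonneg u.holderConst_nonneg v.holderConst_nonneg) fun x y => ?_
      rw [add_mul]
      refine le_trans (le_of_eq ?_) ((abs_add_le _ _).trans
        (add_le_add (u.abs_sub_le_holderConst x y) (v.abs_sub_le_holderConst x y)))
      congr 1
      simp only [add_apply]; ring
    have h2 : ‖(u + v).toCont‖ ≤ ‖u.toCont‖ + ‖v.toCont‖ := norm_add_le _ _
    linarith
  neg' u := by
    have h2 : ‖(-u).toCont‖ = ‖u.toCont‖ := norm_neg u.toCont
    have h1 : (-u).holderConst = u.holderConst := by
      unfold holderConst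
      congr 1
      ext r
      refine exists_congr fun x => exists_congr fun y => and_congr Iff.rfl ?_
      rw [show (-u) x - (-u) y = -(u x - u y) by simp only [neg_apply]; ring, abs_neg]
    rw [h1, h2]
  mul_le' u v := by
    have hu := u.holderConst_nonneg
    have hv := v.holderConst_nonneg
    have h1 : (u * v).holderConst ≤ ‖u.toCont‖ * v.holderConst + ‖v.toCont‖ * u.holderConst := by
      refine holderConst_le (by positivity) fun x y => ?_
      have h : (u * v) x - (u * v) y = u x * (v x - v y) + v y * (u x - u y) := by
        simp only [mul_apply]; ring
      rw [h, add_mul]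
      refine (abs_add_le _ _).trans (add_le_add ?_ ?_)
      · rw [abs_mul, mul_assoc]
        exact mul_le_mul (u.toCont.norm_coe_le_norm x) (v.abs_sub_le_holderConst x y)
          (abs_nonneg _) (norm_nonneg _)
      · rw [abs_mul, mul_assoc]
        exact mul_le_mul (v.toCont.norm_coe_le_norm y) (u.abs_sub_le_holderConst x y)
          (abs_nonneg _) (norm_nonneg _)
    have h2 : ‖(u * v).toCont‖ ≤ ‖u.toCont‖ * ‖v.toCont‖ := norm_mul_le u.toCont v.toCont
    have h3 := mul_nonneg hu hv
    -- The product of the two full norms exceeds the bound by the product of the two Hölder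
    -- constants, which is dropped.
    nlinarith [h1, h2, h3]
  eq_zero_of_map_eq_zero' u h := by
    have h1 := u.holderConst_nonneg
    have h2 : ‖u.toCont‖ = 0 := le_antisymm (by linarith) (norm_nonneg _)
    exact Subtype.ext (norm_eq_zero.1 h2)

instance : NormedCommRing (HolderAlg θ a b) :=
  { (ringNorm θ a b).toNormedRing with
    mul_comm := mul_comm }

theorem norm_def (u : HolderAlg θ a b) : ‖u‖ = ‖u.toCont‖ + u.holderConst := rfl

instance : NormedAlgebra ℝ (HolderAlg θ a b) where
  norm_smul_le c u := by
    have h2 : ‖(c • u).toCont‖ = ‖c‖ * ‖u.toCont‖ := norm_smul c u.toCont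
    have h1 : (c • u).holderConst ≤ ‖c‖ * u.holderConst := by
      refine holderConst_le (mul_nonneg (norm_nonneg _) u.holderConst_nonneg) fun x y => ?_
      rw [show (c • u) x - (c • u) y = c * (u x - u y) by simp only [smul_apply]; ring, abs_mul,
        mul_assoc]
      exact mul_le_mul_of_nonneg_left (u.abs_sub_le_holderConst x y) (abs_nonneg c)
    rw [norm_def, norm_def, h2, mul_add]
    linarith

theorem norm_toCont_le (u : HolderAlg θ a b) : ‖u.toCont‖ ≤ ‖u‖ := by
  rw [norm_def]; linarith [u.holderConst_nonneg]

theorem abs_apply_le_norm_toCont (u : HolderAlg θ a b) (x : Icc a b) : |u x| ≤ ‖u.toCont‖ :=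
  u.toCont.norm_coe_le_norm x

theorem abs_apply_le (u : HolderAlg θ a b) (x : Icc a b) : |u x| ≤ ‖u‖ :=
  (u.abs_apply_le_norm_toCont x).trans u.norm_toCont_le

theorem norm_le {u : HolderAlg θ a b} {B C : ℝ} (hB : 0 ≤ B) (hC : 0 ≤ C)
    (h : ∀ x, |u x| ≤ B) (h' : ∀ x y : Icc a b, |u x - u y| ≤ C * |(x : ℝ) - y| ^ (θ : ℝ)) :
    ‖u‖ ≤ B + C :=
  add_le_add ((ContinuousMap.norm_le _ hB).2 h) (holderConst_le hC h')

/-- The inclusion into the continuous functions. -/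
def toContCLM : HolderAlg θ a b →L[ℝ] C(Icc a b, ℝ) :=
  LinearMap.mkContinuous
    { toFun := toCont, map_add' := fun _ _ => rfl, map_smul' := fun _ _ => rfl } 1
    fun u => (u.norm_toCont_le).trans_eq (one_mul _).symm

/-- Evaluation at a point. -/
def evalCLM (x : Icc a b) : HolderAlg θ a b →L[ℝ] ℝ :=
  LinearMap.mkContinuous
    { toFun := fun u => u x, map_add' := fun _ _ => rfl, map_smul' := fun _ _ => rfl } 1
    fun u => (u.abs_apply_le x).trans_eq (one_mul _).symm

instance : CompleteSpace (HolderAlg θ a b) := by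
  refine Metric.complete_of_cauchySeq_tendsto fun u hu => ?_
  obtain ⟨w, hw⟩ := cauchySeq_tendsto_of_complete
    ((toContCLM (θ := θ) (a := a) (b := b)).uniformContinuous.comp_cauchySeq hu)
  have hpt : ∀ x, Tendsto (fun n => u n x) atTop (𝓝 (w x)) := fun x =>
    ((continuous_eval_const x : Continuous fun g : C(Icc a b, ℝ) => g x).tendsto w).comp hw
  -- The limit `w` exists only uniformly so far; letting m → ∞ in the Cauchy estimate for the Hölder
  -- quotients, at fixed x and y, recovers convergence of the Hölder constants.
  have key : ∀ ε > 0, ∃ N, ∀ n ≥ N, ∀ x y : Icc a b,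
      |(u n x - w x) - (u n y - w y)| ≤ ε * |(x : ℝ) - y| ^ (θ : ℝ) := by
    intro ε hε
    obtain ⟨N, hN⟩ := Metric.cauchySeq_iff.1 hu ε hε
    refine ⟨N, fun n hn x y => ?_⟩
    have hlim : Tendsto (fun m => |(u n x - u m x) - (u n y - u m y)|) atTop
        (𝓝 |(u n x - w x) - (u n y - w y)|) :=
      (((hpt x).const_sub _).sub ((hpt y).const_sub _)).abs
    refine le_of_tendsto hlim (eventually_atTop.2 ⟨N, fun m hm => ?_⟩)
    have h1 := (u n - u m).abs_sub_le_holderConst x y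
    have h2 : (u n - u m).holderConst ≤ ε := by
      have h3 := hN n hn m hm
      rw [dist_eq_norm, norm_def] at h3
      linarith [norm_nonneg (u n - u m).toCont]
    exact h1.trans (mul_le_mul_of_nonneg_right h2 (by positivity))
  have hmem : w ∈ holderSubalgebra θ a b := by
    obtain ⟨N, hN⟩ := key 1 one_pos
    refine ⟨1 + (u N).holderConst, fun x y => ?_⟩
    have h1 := hN N le_rfl x y
    have h2 := (u N).abs_sub_le_holderConst x y
    rw [add_mul]
    have h3 : w x - w y = -((u N x - w x) - (u N y - w y)) + (u N x - u N y) := by ring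
    rw [h3]
    refine (abs_add_le _ _).trans (add_le_add ?_ h2)
    rwa [abs_neg]
  let w' : HolderAlg θ a b := ⟨w, hmem⟩
  refine ⟨w', ?_⟩
  rw [Metric.tendsto_atTop]
  intro ε hε
  obtain ⟨N1, hN1⟩ := key (ε / 4) (by positivity)
  obtain ⟨N2, hN2⟩ := Metric.tendsto_atTop.1 hw (ε / 4) (by positivity)
  refine ⟨max N1 N2, fun n hn => ?_⟩
  have h2 := hN2 n ((le_max_right _ _).trans hn)
  rw [dist_eq_norm] at h2 ⊢
  have h3 : ‖(u n - w').toCont‖ < ε / 4 := h2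
  have h4 : (u n - w').holderConst ≤ ε / 4 :=
    holderConst_le (by positivity) fun x y => hN1 n ((le_max_left _ _).trans hn) x y
  rw [norm_def]
  linarith

/-- The reciprocal is bounded by compactness, and 1/s - 1/t = -(s - t)/(s t) transfers the Hölder
bound. Division by a nowhere vanishing function thus becomes `Ring.inverse`, which is differentiable
at units of a Banach algebra. -/
theorem isUnit_of_forall_ne_zero {u : HolderAlg θ a b} (h : ∀ x, u x ≠ 0) : IsUnit u := by
  let v : C(Icc a b, ℝ) := ⟨fun x => (u x)⁻¹, u.continuous_coe.inv₀ h⟩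
  have hv : v ∈ holderSubalgebra θ a b := by
    refine ⟨‖v‖ * ‖v‖ * u.holderConst, fun x y => ?_⟩
    have h1 : v x - v y = v x * v y * -(u x - u y) := by
      have := h x
      have := h y
      simp only [v, ContinuousMap.coe_mk]
      field_simp
      ring
    rw [h1, abs_mul, abs_neg, mul_assoc (‖v‖ * ‖v‖), abs_mul]
    gcongr
    · exact v.norm_coe_le_norm x
    · exact v.norm_coe_le_norm y
    · exact u.abs_sub_le_holderConst x y
  refine IsUnit.of_mul_eq_one (⟨v, hv⟩ : HolderAlg θ a b) ?_
  ext x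
  exact mul_inv_cancel₀ (h x)

theorem inverse_apply {u : HolderAlg θ a b} (h : IsUnit u) (x : Icc a b) :
    (Ring.inverse u) x = (u x)⁻¹ := by
  have h1 := congrArg (fun w : HolderAlg θ a b => w x) (Ring.mul_inverse_cancel u h)
  simp only [mul_apply, one_apply] at h1
  exact eq_inv_of_mul_eq_one_right h1

/-- The difference of the roots is the difference of the values divided by the sum of the roots, and
that sum is bounded below on the compact interval. -/
theorem exists_sqrt {u : HolderAlg θ a b} (h : ∀ x, 0 < u x) :
    ∃ s : HolderAlg θ a b, ∀ x, s x = Real.sqrt (u x) := by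
  let v : C(Icc a b, ℝ) := ⟨fun x => Real.sqrt (u x), u.continuous_coe.sqrt⟩
  let i : C(Icc a b, ℝ) :=
    ⟨fun x => (Real.sqrt (u x))⁻¹, u.continuous_coe.sqrt.inv₀ fun x => (Real.sqrt_pos.2 (h x)).ne'⟩
  refine ⟨⟨v, ‖i‖ * u.holderConst, fun x y => ?_⟩, fun x => rfl⟩
  have hx := Real.sqrt_pos.2 (h x)
  have hy := Real.sqrt_pos.2 (h y)
  have h1 : v x - v y = (v x + v y)⁻¹ * (u x - u y) := by
    have h2 : u x - u y = v x ^ 2 - v y ^ 2 := by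
      simp only [v, ContinuousMap.coe_mk, Real.sq_sqrt (h _).le]
    have h3 : v x + v y ≠ 0 := (add_pos hx hy).ne'
    rw [h2]
    field_simp
    ring
  have h4 : |(v x + v y)⁻¹| ≤ ‖i‖ := by
    refine le_trans ?_ (i.norm_coe_le_norm x)
    have h5 : ‖i x‖ = (Real.sqrt (u x))⁻¹ := Real.norm_of_nonneg (inv_nonneg.2 hx.le)
    have h6 : |(v x + v y)⁻¹| = (Real.sqrt (u x) + Real.sqrt (u y))⁻¹ :=
      abs_of_nonneg (inv_nonneg.2 (add_pos hx hy).le)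
    rw [h5, h6]
    exact inv_anti₀ hx (le_add_of_nonneg_right hy.le)
  rw [h1, abs_mul, mul_assoc]
  exact mul_le_mul h4 (u.abs_sub_le_holderConst x y) (abs_nonneg _) (norm_nonneg _)

/-- Near a square of a positive element, the pointwise square root is differentiable. -/
theorem exists_differentiableAt_sqrt [hab : Fact (a < b)] {r : HolderAlg θ a b}
    (hr : ∀ x, 0 < r x) :
    ∃ R : HolderAlg θ a b → HolderAlg θ a b, DifferentiableAt ℝ R (r * r) ∧ R (r * r) = r ∧
      ∀ᶠ u in 𝓝 (r * r), ∀ x, 0 < R u x ∧ R u x = Real.sqrt (u x) := by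
  obtain ⟨i, hi⟩ : ∃ i : HolderAlg θ a b, r * i = 1 :=
    (isUnit_of_forall_ne_zero fun x => (hr x).ne').exists_right_inv
  -- Multiplication by 2r, the derivative of squaring at r, is invertible because r is a unit; `R`
  -- is the local inverse supplied by the inverse function theorem.
  let L : HolderAlg θ a b ≃L[ℝ] HolderAlg θ a b :=
    ContinuousLinearEquiv.equivOfInverse
      ((2 : ℝ) • ContinuousLinearMap.mul ℝ (HolderAlg θ a b) r)
      ((1 / 2 : ℝ) • ContinuousLinearMap.mul ℝ (HolderAlg θ a b) i)
      (fun u => by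
        simp only [_root_.smul_apply, ContinuousLinearMap.mul_apply', mul_smul_comm,
          smul_smul, ← mul_assoc]
        rw [mul_comm i, hi]; norm_num)
      (fun u => by
        simp only [_root_.smul_apply, ContinuousLinearMap.mul_apply', mul_smul_comm,
          smul_smul, ← mul_assoc]
        rw [hi]; norm_num)
  have hd : HasStrictFDerivAt (fun s : HolderAlg θ a b => s * s)
      (L : HolderAlg θ a b →L[ℝ] HolderAlg θ a b) r := by
    refine ((hasStrictFDerivAt_id (𝕜 := ℝ) r).mul (hasStrictFDerivAt_id r)).congr_fderiv ?_
    refine ContinuousLinearMap.ext fun u => ?_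
    change r * u + r * u = (2 : ℝ) • (r * u)
    rw [two_smul]
  refine ⟨hd.localInverse _ _ _, hd.to_localInverse.hasFDerivAt.differentiableAt,
    hd.localInverse_apply_image, ?_⟩
  have hc : Tendsto (hd.localInverse _ _ _) (𝓝 (r * r)) (𝓝 r) := by
    have h := hd.to_localInverse.hasFDerivAt.differentiableAt.continuousAt
    have h' := h.tendsto
    rwa [hd.localInverse_apply_image] at h'
  have : Nonempty (Icc a b) := ⟨⟨a, left_mem_Icc.2 hab.out.le⟩⟩
  -- The minimum of r is the radius of the ball in which the local inverse stays positive.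
  -- Positivity selects the nonnegative square root among the pointwise solutions of s^2 = u.
  obtain ⟨x₀, -, hx₀⟩ := isCompact_univ.exists_isMinOn univ_nonempty r.continuous_coe.continuousOn
  filter_upwards [hd.eventually_right_inverse, hc (Metric.ball_mem_nhds r (hr x₀))] with u h1 h2 x
  have h3 : r x₀ ≤ r x := hx₀ (mem_univ x)
  have h4 := ((hd.localInverse _ _ _ u) - r).abs_apply_le x
  rw [mem_preimage, mem_ball_iff_norm] at h2
  have h5 := (abs_lt.1 (h4.trans_lt h2)).1
  rw [sub_apply] at h5
  have h6 : 0 < (hd.localInverse _ _ _ u) x := by linarith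
  refine ⟨h6, ?_⟩
  conv_rhs => rw [← h1]
  rw [mul_apply, Real.sqrt_mul_self h6.le]

end HolderAlg

/-! ### Integration from the left endpoint and second-order Volterra equations. -/

namespace HolderAlg

variable {θ : ℝ≥0} {a b : ℝ} [hab : Fact (a < b)]

/-- The left endpoint. -/
def left (a b : ℝ) [hab : Fact (a < b)] : Icc a b := ⟨a, left_mem_Icc.2 hab.out.le⟩

/-- The right endpoint. -/
def right (a b : ℝ) [hab : Fact (a < b)] : Icc a b := ⟨b, right_mem_Icc.2 hab.out.le⟩

/-- The extension to the real line that is constant outside of `[a, b]`. -/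
def extend (u : HolderAlg θ a b) : ℝ → ℝ := IccExtend hab.out.le u

theorem continuous_extend (u : HolderAlg θ a b) : Continuous u.extend :=
  u.continuous_coe.Icc_extend'

@[simp] theorem extend_coe (u : HolderAlg θ a b) (x : Icc a b) : u.extend x = u x :=
  IccExtend_val _ _ x

theorem abs_extend_le (u : HolderAlg θ a b) (x : ℝ) : |u.extend x| ≤ ‖u.toCont‖ :=
  u.abs_apply_le_norm_toCont _

/-- The primitive of the extension that vanishes at `a`. -/
def primitive (u : HolderAlg θ a b) (x : ℝ) : ℝ := ∫ t in a..x, u.extend t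

theorem hasDerivAt_primitive (u : HolderAlg θ a b) (x : ℝ) :
    HasDerivAt u.primitive (u.extend x) x :=
  (u.continuous_extend.integral_hasStrictDerivAt a x).hasDerivAt

@[simp] theorem primitive_left (u : HolderAlg θ a b) : u.primitive a = 0 :=
  intervalIntegral.integral_same

theorem abs_primitive_sub_le (u : HolderAlg θ a b) (x y : ℝ) :
    |u.primitive x - u.primitive y| ≤ ‖u.toCont‖ * |x - y| := by
  have h : u.primitive x - u.primitive y = ∫ t in y..x, u.extend t :=
    intervalIntegral.integral_interval_sub_left (u.continuous_extend.intervalIntegrable _ _)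
      (u.continuous_extend.intervalIntegrable _ _)
  rw [h]
  exact intervalIntegral.norm_integral_le_of_norm_le_const (f := u.extend)
    fun t _ => u.abs_extend_le t

theorem abs_primitive_le (u : HolderAlg θ a b) (x : Icc a b) :
    |u.primitive x| ≤ ‖u.toCont‖ * (b - a) := by
  have h := u.abs_primitive_sub_le x a
  rw [primitive_left, sub_zero] at h
  refine h.trans (mul_le_mul_of_nonneg_left ?_ (norm_nonneg _))
  rw [abs_of_nonneg (sub_nonneg.2 x.2.1)]
  linarith [x.2.2]

theorem abs_sub_le_rpow {θ : ℝ≥0} [hθ : Fact (θ ≤ 1)] {a b : ℝ} (x y : Icc a b) :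
    |(x : ℝ) - y| ≤ (b - a) ^ (1 - θ : ℝ) * |(x : ℝ) - y| ^ (θ : ℝ) := by
  have hθ1 : (0 : ℝ) ≤ 1 - θ := sub_nonneg.2 (by exact_mod_cast hθ.out)
  rcases eq_or_ne x y with rfl | hxy
  · simp only [sub_self, abs_zero]
    have : (0 : ℝ) ≤ b - a := by linarith [x.2.1, x.2.2]
    positivity
  · have hpos : 0 < |(x : ℝ) - y| := abs_pos.2 (sub_ne_zero.2 fun h' => hxy (Subtype.ext h'))
    calc |(x : ℝ) - y| = |(x : ℝ) - y| ^ (1 - θ : ℝ) * |(x : ℝ) - y| ^ (θ : ℝ) := by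
          rw [← Real.rpow_add hpos, sub_add_cancel, Real.rpow_one]
      _ ≤ _ := by
          refine mul_le_mul_of_nonneg_right (Real.rpow_le_rpow hpos.le ?_ hθ1) (by positivity)
          rw [abs_le]
          constructor <;> linarith [x.2.1, x.2.2, y.2.1, y.2.2]

/-- A bound for the integration operator. -/
def volterraBound (θ : ℝ≥0) (a b : ℝ) : ℝ := (b - a) + (b - a) ^ (1 - θ : ℝ)

theorem volterraBound_nonneg : 0 ≤ volterraBound θ a b := by
  have : (0 : ℝ) ≤ b - a := sub_nonneg.2 hab.out.le
  unfold volterraBound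
  positivity

variable [hθ : Fact (θ ≤ 1)]

/-- The primitive as a Hölder function. -/
def volterraFun (u : HolderAlg θ a b) : HolderAlg θ a b :=
  ⟨⟨fun x => u.primitive x, (continuous_iff_continuousAt.2 fun x =>
      (u.hasDerivAt_primitive x).continuousAt).comp continuous_subtype_val⟩,
    ‖u.toCont‖ * (b - a) ^ (1 - θ : ℝ), fun x y => by
      rw [mul_assoc]
      exact (u.abs_primitive_sub_le x y).trans
        (mul_le_mul_of_nonneg_left (abs_sub_le_rpow x y) (norm_nonneg _))⟩

/-- Only the sup norm of `u` enters, so integration gains regularity: decay in the sup norm can be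
upgraded to decay in the Hölder norm. -/
theorem norm_volterraFun_le (u : HolderAlg θ a b) :
    ‖u.volterraFun‖ ≤ volterraBound θ a b * ‖u.toCont‖ := by
  have hab' : (0 : ℝ) ≤ b - a := sub_nonneg.2 hab.out.le
  refine (norm_le (B := ‖u.toCont‖ * (b - a)) (C := ‖u.toCont‖ * (b - a) ^ (1 - θ : ℝ))
    (by positivity) (by positivity) u.abs_primitive_le fun x y => ?_).trans_eq ?_
  · rw [mul_assoc]
    exact (u.abs_primitive_sub_le x y).trans
      (mul_le_mul_of_nonneg_left (abs_sub_le_rpow x y) (norm_nonneg _))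
  · unfold volterraBound; ring

/-- Integration from the left endpoint. -/
def volterra : HolderAlg θ a b →L[ℝ] HolderAlg θ a b :=
  LinearMap.mkContinuous
    { toFun := volterraFun
      map_add' := fun u v => HolderAlg.ext fun _ =>
        intervalIntegral.integral_add (u.continuous_extend.intervalIntegrable _ _)
          (v.continuous_extend.intervalIntegrable _ _)
      map_smul' := fun c u => HolderAlg.ext fun _ =>
        intervalIntegral.integral_const_mul c u.extend } (volterraBound θ a b)
    fun u => u.norm_volterraFun_le.trans
      (mul_le_mul_of_nonneg_left u.norm_toCont_le volterraBound_nonneg)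

theorem volterra_apply (u : HolderAlg θ a b) (x : Icc a b) : (volterra u) x = u.primitive x := rfl

theorem norm_volterra_le (u : HolderAlg θ a b) :
    ‖volterra u‖ ≤ volterraBound θ a b * ‖u.toCont‖ := u.norm_volterraFun_le

/-- In the sup norm weighted by exp(l(x - a)), integration costs only a factor 1/l, so a large l
makes Volterra operators contractive. -/
theorem abs_volterra_le_exp {u : HolderAlg θ a b} {B l : ℝ} (hB : 0 ≤ B) (hl : 0 < l)
    (h : ∀ x : Icc a b, |u x| ≤ B * Real.exp (l * (x - a))) (x : Icc a b) :
    |(volterra u) x| ≤ B / l * Real.exp (l * (x - a)) := by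
  have hd : ∀ t : ℝ, HasDerivAt (fun t => B / l * Real.exp (l * (t - a)))
      (B * Real.exp (l * (t - a))) t := by
    intro t
    have h1 := ((((hasDerivAt_id t).sub_const a).const_mul l).exp).const_mul (B / l)
    refine h1.congr_deriv ?_
    field_simp
    simp
  have hc : Continuous fun t => B * Real.exp (l * (t - a)) := by fun_prop
  have h1 : |u.primitive x| ≤ ∫ t in a..x, B * Real.exp (l * (t - a)) := by
    refine intervalIntegral.norm_integral_le_of_norm_le (f := u.extend) x.2.1 ?_ (hc.intervalIntegrable _ _)
    refine Filter.Eventually.of_forall fun t ht => ?_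
    have := h ⟨t, ht.1.le, ht.2.trans x.2.2⟩
    rwa [← extend_coe u] at this
  rw [intervalIntegral.integral_eq_sub_of_hasDerivAt (fun t _ => hd t)
    (hc.intervalIntegrable _ _)] at h1
  rw [volterra_apply]
  have : 0 ≤ B / l * Real.exp (l * (a - a)) := by positivity
  linarith

/-- Second-order Volterra operators are small perturbations of the identity in the sense that adding
the identity gives an isomorphism. -/
theorem exists_add_volterra_eq (p q g : HolderAlg θ a b) :
    ∃ w, w + (p * volterra w + q * volterra (volterra w)) = g := by
  let K : HolderAlg θ a b →L[ℝ] HolderAlg θ a b :=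
    -((ContinuousLinearMap.mul ℝ _ p).comp volterra +
      (ContinuousLinearMap.mul ℝ _ q).comp (volterra.comp volterra))
  have hK : ∀ w, K w = -(p * volterra w + q * volterra (volterra w)) := fun w => rfl
  set M := ‖p‖ + ‖q‖ with hM
  have hM0 : 0 ≤ M := by positivity
  -- This choice gives M / l ≤ 1/2, and l ≥ 1 lets the double integral obey the same bound as the
  -- single one.
  set l := 1 + 2 * M with hl
  have hl1 : 1 ≤ l := by linarith
  have hl0 : 0 < l := by linarith
  have step : ∀ (w : HolderAlg θ a b) (B : ℝ), 0 ≤ B →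
      (∀ x : Icc a b, |w x| ≤ B * Real.exp (l * (x - a))) →
      ∀ x : Icc a b, |(K w) x| ≤ B / 2 * Real.exp (l * (x - a)) := by
    intro w B hB h x
    have h1 := abs_volterra_le_exp hB hl0 h
    have h2 := abs_volterra_le_exp (by positivity) hl0 h1 x
    have h3 : B / l / l ≤ B / l := div_le_self (by positivity) hl1
    have hp := p.abs_apply_le x
    have hq := q.abs_apply_le x
    have he := Real.exp_pos (l * (x - a))
    rw [hK, neg_apply, abs_neg, add_apply, mul_apply, mul_apply]
    calc |p x * (volterra w) x + q x * (volterra (volterra w)) x|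
        ≤ |p x| * |(volterra w) x| + |q x| * |(volterra (volterra w)) x| := by
          rw [← abs_mul, ← abs_mul]; exact abs_add_le _ _
      _ ≤ ‖p‖ * (B / l * Real.exp (l * (x - a))) + ‖q‖ * (B / l * Real.exp (l * (x - a))) := by
          have h4 := h1 x
          have h5 := h2.trans (mul_le_mul_of_nonneg_right h3 he.le)
          gcongr
      _ = M / l * B * Real.exp (l * (x - a)) := by rw [hM]; ring
      _ ≤ 1 / 2 * B * Real.exp (l * (x - a)) := by
          have : M / l ≤ 1 / 2 := by rw [div_le_iff₀ hl0]; linarith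
          gcongr
      _ = B / 2 * Real.exp (l * (x - a)) := by ring
  have iter : ∀ (n : ℕ) (w : HolderAlg θ a b) (x : Icc a b),
      |((K ^ n) w) x| ≤ ‖w‖ / 2 ^ n * Real.exp (l * (x - a)) := by
    intro n w
    induction n with
    | zero =>
      intro x
      have h1 : 1 ≤ Real.exp (l * (x - a)) :=
        Real.one_le_exp (mul_nonneg hl0.le (sub_nonneg.2 x.2.1))
      rw [pow_zero, pow_zero, div_one]
      exact (w.abs_apply_le x).trans (le_mul_of_one_le_right (norm_nonneg _) h1)
    | succ n ih =>
      intro x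
      rw [pow_succ' K, mul_apply_eq_comp, pow_succ, ← div_div]
      exact step _ _ (by positivity) ih x
  set E := Real.exp (l * (b - a)) with hE
  have hE0 : 0 < E := Real.exp_pos _
  have hsup : ∀ (n : ℕ) (w : HolderAlg θ a b), ‖((K ^ n) w).toCont‖ ≤ E / 2 ^ n * ‖w‖ := by
    intro n w
    refine (ContinuousMap.norm_le _ (by positivity)).2 fun x => (iter n w x).trans ?_
    have : Real.exp (l * (x - a)) ≤ E :=
      Real.exp_le_exp.2 (mul_le_mul_of_nonneg_left (by linarith [x.2.2]) hl0.le)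
    calc ‖w‖ / 2 ^ n * Real.exp (l * (x - a)) ≤ ‖w‖ / 2 ^ n * E := by gcongr
      _ = _ := by ring
  set Cv := volterraBound θ a b with hCv
  have hCv0 : 0 ≤ Cv := volterraBound_nonneg
  have hKn : ∀ w : HolderAlg θ a b, ‖K w‖ ≤ (‖p‖ * Cv + ‖q‖ * (Cv * Cv)) * ‖w.toCont‖ := by
    intro w
    have h1 := w.norm_volterra_le
    have h2 : ‖volterra (volterra w)‖ ≤ Cv * (Cv * ‖w.toCont‖) :=
      (norm_volterra_le _).trans
        (mul_le_mul_of_nonneg_left ((norm_toCont_le _).trans h1) hCv0)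
    rw [hK, norm_neg]
    calc _ ≤ ‖p‖ * ‖volterra w‖ + ‖q‖ * ‖volterra (volterra w)‖ :=
          (norm_add_le _ _).trans (add_le_add (norm_mul_le _ _) (norm_mul_le _ _))
      _ ≤ ‖p‖ * (Cv * ‖w.toCont‖) + ‖q‖ * (Cv * (Cv * ‖w.toCont‖)) := by gcongr
      _ = _ := by ring
  set D := (‖p‖ * Cv + ‖q‖ * (Cv * Cv)) * E with hD
  have hD0 : 0 ≤ D := by positivity
  obtain ⟨n, hn⟩ := exists_pow_lt_of_lt_one (show 0 < 1 / (D + 1) by positivity)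
    (show (1 / 2 : ℝ) < 1 by norm_num)
  -- The first n applications of `K` decay in the sup norm; the last one turns this into decay in
  -- the Hölder norm, at the cost of a fixed constant.
  have hsmall : ‖K ^ (n + 1)‖ < 1 := by
    have h2 : ‖K ^ (n + 1)‖ ≤ D * (1 / 2) ^ n := by
      refine ContinuousLinearMap.opNorm_le_bound _ (by positivity) fun w => ?_
      rw [pow_succ' K, mul_apply_eq_comp]
      refine (hKn _).trans ((mul_le_mul_of_nonneg_left (hsup n w) (by positivity)).trans_eq ?_)
      rw [hD, one_div, inv_pow]
      ring
    have h3 : (D + 1) * (1 / 2 : ℝ) ^ n < 1 := by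
      have := (lt_div_iff₀ (by positivity : 0 < D + 1)).1 hn
      linarith
    have h4 : 0 ≤ (1 / 2 : ℝ) ^ n := by positivity
    linarith
  have hunit : IsUnit (1 - K ^ (n + 1)) := (Units.oneSub _ hsmall).isUnit
  obtain ⟨S, hS⟩ := hunit.exists_right_inv
  refine ⟨(∑ i ∈ Finset.range (n + 1), K ^ i) (S g), ?_⟩
  -- `K` itself need not have norm below one; the finite geometric sum passes from an inverse of 1 -
  -- K^(n+1) to a right inverse of 1 - K.
  have h5 : (1 - K) * ((∑ i ∈ Finset.range (n + 1), K ^ i) * S) = 1 := by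
    rw [← mul_assoc, mul_neg_geom_sum, hS]
  have h6 := congrArg (fun T : HolderAlg θ a b →L[ℝ] HolderAlg θ a b => T g) h5
  rw [← sub_neg_eq_add, ← hK]
  exact h6

end HolderAlg

/-! ### Functions of class 2 + θ as Cauchy data, and comparison of norms. -/

/-- Functions of class `2 + θ` on `[a, b]`, given by the value and the first derivative at `a` and
by the second derivative. -/
abbrev C2Data (θ : ℝ≥0) (a b : ℝ) : Type := ℝ × ℝ × HolderAlg θ a b

namespace C2Data

open HolderAlg

variable {θ : ℝ≥0} {a b : ℝ} [hab : Fact (a < b)] [hθ : Fact (θ ≤ 1)]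

/-- The second derivative. -/
def snd' : C2Data θ a b →L[ℝ] HolderAlg θ a b :=
  (ContinuousLinearMap.snd ℝ ℝ (HolderAlg θ a b)).comp
    (ContinuousLinearMap.snd ℝ ℝ (ℝ × HolderAlg θ a b))

/-- The first derivative. -/
def fst' : C2Data θ a b →L[ℝ] HolderAlg θ a b :=
  (ContinuousLinearMap.toSpanSingleton ℝ (1 : HolderAlg θ a b)).comp
    ((ContinuousLinearMap.fst ℝ ℝ (HolderAlg θ a b)).comp
      (ContinuousLinearMap.snd ℝ ℝ (ℝ × HolderAlg θ a b))) + volterra.comp snd'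

/-- The function itself. -/
def val : C2Data θ a b →L[ℝ] HolderAlg θ a b :=
  (ContinuousLinearMap.toSpanSingleton ℝ (1 : HolderAlg θ a b)).comp
    (ContinuousLinearMap.fst ℝ ℝ (ℝ × HolderAlg θ a b)) + volterra.comp fst'

end C2Data

open HolderAlg C2Data

section calculus

variable {a b : ℝ}

theorem d1_eq_of_hasDerivWithinAt (hab : a < b) {u u₁ : ℝ → ℝ} {x : ℝ} (hx : x ∈ Icc a b)
    (h : HasDerivWithinAt u (u₁ x) (Icc a b) x) : d1 (Icc a b) u x = u₁ x := by
  rw [d1, iteratedDerivWithin_one]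
  exact h.derivWithin (uniqueDiffOn_Icc hab x hx)

theorem d2_eq_of_hasDerivWithinAt (hab : a < b) {u u₁ u₂ : ℝ → ℝ}
    (h₁ : ∀ x ∈ Icc a b, HasDerivWithinAt u (u₁ x) (Icc a b) x) {x : ℝ} (hx : x ∈ Icc a b)
    (h₂ : HasDerivWithinAt u₁ (u₂ x) (Icc a b) x) : d2 (Icc a b) u x = u₂ x := by
  rw [d2, iteratedDerivWithin_succ]
  exact (h₂.congr (fun y hy => d1_eq_of_hasDerivWithinAt hab hy (h₁ y hy))
    (d1_eq_of_hasDerivWithinAt hab hx (h₁ x hx))).derivWithin (uniqueDiffOn_Icc hab x hx)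

theorem hasDerivWithinAt_d1 {u : ℝ → ℝ} {n : WithTop ℕ∞}
    (hu : ContDiffOn ℝ n u (Icc a b)) (hn : 1 ≤ n) {x : ℝ} (hx : x ∈ Icc a b) :
    HasDerivWithinAt u (d1 (Icc a b) u x) (Icc a b) x := by
  rw [d1, iteratedDerivWithin_one]
  exact (hu.differentiableOn (by positivity) x hx).hasDerivWithinAt

theorem hasDerivWithinAt_d2 (hab : a < b) {u : ℝ → ℝ} {n : WithTop ℕ∞}
    (hu : ContDiffOn ℝ n u (Icc a b)) (hn : 2 ≤ n) {x : ℝ} (hx : x ∈ Icc a b) :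
    HasDerivWithinAt (d1 (Icc a b) u) (d2 (Icc a b) u x) (Icc a b) x := by
  rw [d2, iteratedDerivWithin_succ]
  exact (hu.differentiableOn_iteratedDerivWithin
    (lt_of_lt_of_le (by norm_num) hn) (uniqueDiffOn_Icc hab) x hx).hasDerivWithinAt

end calculus

variable {θ : ℝ≥0} {a b : ℝ}

theorem supNorm_eq_norm {g : ℝ → ℝ} {u : HolderAlg θ a b} (h : ∀ x : Icc a b, g x = u x) :
    supNorm (Icc a b) g = ‖u.toCont‖ := by
  rw [supNorm, sSup_image', ContinuousMap.norm_eq_iSup_norm]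
  exact iSup_congr fun x => by rw [h x]; rfl

theorem holderSeminorm_eq {g : ℝ → ℝ} {u : HolderAlg θ a b} (h : ∀ x : Icc a b, g x = u x) :
    holderSeminorm θ (Icc a b) g = u.holderConst := by
  unfold holderSeminorm holderConst
  congr 1
  ext r
  constructor
  · rintro ⟨x, hx, y, hy, hxy, rfl⟩
    exact ⟨⟨x, hx⟩, ⟨y, hy⟩, fun h' => hxy (congrArg Subtype.val h'), by
      rw [← h ⟨x, hx⟩, ← h ⟨y, hy⟩]⟩
  · rintro ⟨x, y, hxy, rfl⟩
    exact ⟨x, x.2, y, y.2, fun h' => hxy (Subtype.ext h'), by rw [h x, h y]⟩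

/-- A continuous function with a Hölder bound as an element of the Hölder space. -/
theorem exists_holderAlg {g : ℝ → ℝ} (hc : ContinuousOn g (Icc a b)) {C : ℝ≥0}
    (hC : HolderOnWith C θ g (Icc a b)) : ∃ u : HolderAlg θ a b, ∀ x : Icc a b, u x = g x := by
  refine ⟨⟨⟨(Icc a b).domRestrict g, hc.domRestrict⟩, C, fun x y => ?_⟩, fun x => rfl⟩
  exact hC.dist_le x.2 y.2

theorem HolderAlg.holderOnWith_of_eq {g : ℝ → ℝ} {u : HolderAlg θ a b}
    (h : ∀ x : Icc a b, g x = u x) :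
    HolderOnWith u.holderConst.toNNReal θ g (Icc a b) := by
  intro x hx y hy
  have h1 := u.abs_sub_le_holderConst ⟨x, hx⟩ ⟨y, hy⟩
  rw [← h, ← h] at h1
  rw [edist_dist, edist_dist, Real.dist_eq, Real.dist_eq,
    ENNReal.ofReal_rpow_of_nonneg (abs_nonneg _) θ.coe_nonneg]
  change _ ≤ ENNReal.ofReal u.holderConst * _
  rw [← ENNReal.ofReal_mul u.holderConst_nonneg]
  exact ENNReal.ofReal_le_ofReal h1

theorem HolderAlg.continuousOn_of_eq {g : ℝ → ℝ} {u : HolderAlg θ a b}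
    (h : ∀ x : Icc a b, g x = u x) : ContinuousOn g (Icc a b) := by
  rw [continuousOn_iff_continuous_domRestrict]
  convert u.continuous_coe using 1
  exact funext h

section

variable [hab : Fact (a < b)]

theorem HolderAlg.hasDerivWithinAt_of_eq_primitive {v : ℝ → ℝ} {c : ℝ} {w : HolderAlg θ a b}
    (h : ∀ x : Icc a b, v x = c + w.primitive x) (x : Icc a b) :
    HasDerivWithinAt v (w x) (Icc a b) x := by
  have h1 := ((w.hasDerivAt_primitive x).const_add c).hasDerivWithinAt (s := Icc a b)
  rw [extend_coe] at h1
  exact h1.congr (fun y hy => h ⟨y, hy⟩) (h x)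

/-- The fundamental theorem of calculus for one-sided derivatives at the endpoints; applied twice,
it recovers a function from its Cauchy data. -/
theorem HolderAlg.eq_primitive_of_hasDerivWithinAt {v : ℝ → ℝ} {w : HolderAlg θ a b}
    (h : ∀ x : Icc a b, HasDerivWithinAt v (w x) (Icc a b) x) (x : Icc a b) :
    v x = v a + w.primitive x := by
  have h1 : ∀ x : Icc a b, HasDerivWithinAt (fun t => v a + w.primitive t) (w x) (Icc a b) x :=
    hasDerivWithinAt_of_eq_primitive fun _ => rfl
  refine eq_of_derivWithin_eq (f := v) (g := fun t => v a + w.primitive t)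
    (fun t ht => (h ⟨t, ht⟩).differentiableWithinAt)
    (fun t ht => (h1 ⟨t, ht⟩).differentiableWithinAt) (fun t ht => ?_) (by simp) x x.2
  have ht' := Ico_subset_Icc_self ht
  have hu := uniqueDiffOn_Icc hab.out t ht'
  rw [(h ⟨t, ht'⟩).derivWithin hu, (h1 ⟨t, ht'⟩).derivWithin hu]

end

section

variable [hab : Fact (a < b)] [hθ : Fact (θ ≤ 1)]

namespace C2Data

theorem fst'_apply (z : C2Data θ a b) (x : Icc a b) :
    (fst' z) x = z.2.1 + (snd' z).primitive x := by
  change z.2.1 * 1 + _ = _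
  rw [mul_one]; rfl

theorem val_apply (z : C2Data θ a b) (x : Icc a b) :
    (val z) x = z.1 + (fst' z).primitive x := by
  change z.1 * 1 + _ = _
  rw [mul_one]; rfl

theorem val_left (z : C2Data θ a b) : (val z) (left a b) = z.1 := by
  rw [val_apply]
  exact (congrArg _ (primitive_left _)).trans (add_zero _)

theorem fst'_left (z : C2Data θ a b) : (fst' z) (left a b) = z.2.1 := by
  rw [fst'_apply]
  exact (congrArg _ (primitive_left _)).trans (add_zero _)

end C2Data

/-- On `[a, b]` the function `u` is the one described by `z`. -/
def Represents (u : ℝ → ℝ) (z : C2Data θ a b) : Prop := ∀ x : Icc a b, u x = (val z) x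

theorem represents_extend (z : C2Data θ a b) : Represents (val z).extend z :=
  fun x => extend_coe _ x

namespace Represents

variable {u : ℝ → ℝ} {z : C2Data θ a b}

theorem hasDerivWithinAt (h : Represents u z) (x : Icc a b) :
    HasDerivWithinAt u ((fst' z) x) (Icc a b) x :=
  hasDerivWithinAt_of_eq_primitive (fun x => (h x).trans (val_apply z x)) x

theorem hasDerivWithinAt_fst' (z : C2Data θ a b) (x : Icc a b) :
    HasDerivWithinAt (fst' z).extend ((snd' z) x) (Icc a b) x :=
  hasDerivWithinAt_of_eq_primitive (fun x => (extend_coe _ x).trans (fst'_apply z x)) x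

theorem d1_eq (h : Represents u z) (x : Icc a b) : d1 (Icc a b) u x = (fst' z) x := by
  rw [← extend_coe]
  refine d1_eq_of_hasDerivWithinAt hab.out x.2 ?_
  rw [extend_coe]
  exact h.hasDerivWithinAt x

theorem d2_eq (h : Represents u z) (x : Icc a b) : d2 (Icc a b) u x = (snd' z) x := by
  rw [← extend_coe (snd' z)]
  refine d2_eq_of_hasDerivWithinAt hab.out (u₁ := (fst' z).extend) (fun y hy => ?_) x.2 ?_
  · rw [extend_coe (fst' z) ⟨y, hy⟩]
    exact h.hasDerivWithinAt ⟨y, hy⟩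
  · rw [extend_coe]
    exact hasDerivWithinAt_fst' z x

theorem memCHolder (h : Represents u z) : MemCHolder 2 θ (Icc a b) u := by
  have hU := uniqueDiffOn_Icc hab.out
  refine ⟨?_, _, holderOnWith_of_eq h.d2_eq⟩
  rw [Nat.cast_ofNat, show (2 : WithTop ℕ∞) = 1 + 1 by norm_num,
    contDiffOn_succ_iff_derivWithin hU]
  refine ⟨fun x hx => (h.hasDerivWithinAt ⟨x, hx⟩).differentiableWithinAt, by simp, ?_⟩
  rw [show (1 : WithTop ℕ∞) = 0 + 1 by norm_num, contDiffOn_succ_iff_derivWithin hU]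
  have e1 : EqOn (derivWithin u (Icc a b)) (fst' z).extend (Icc a b) := fun x hx => by
    rw [(h.hasDerivWithinAt ⟨x, hx⟩).derivWithin (hU x hx)]
    exact (extend_coe (fst' z) ⟨x, hx⟩).symm
  have hd : ∀ x (hx : x ∈ Icc a b),
      HasDerivWithinAt (derivWithin u (Icc a b)) ((snd' z) ⟨x, hx⟩) (Icc a b) x := fun x hx =>
    (hasDerivWithinAt_fst' z ⟨x, hx⟩).congr e1 (e1 hx)
  refine ⟨fun x hx => (hd x hx).differentiableWithinAt, by simp, contDiffOn_zero.2 ?_⟩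
  exact continuousOn_of_eq (u := snd' z) fun x => (hd x x.2).derivWithin (hU x x.2)

theorem cHolderNorm_eq (h : Represents u z) :
    cHolderNorm 2 θ (Icc a b) u = ‖(val z).toCont‖ + ‖(fst' z).toCont‖ + ‖snd' z‖ := by
  have h0 : supNorm (Icc a b) (iteratedDerivWithin 0 u (Icc a b)) = ‖(val z).toCont‖ :=
    supNorm_eq_norm fun x => by rw [iteratedDerivWithin_zero]; exact h x
  have h1 : supNorm (Icc a b) (iteratedDerivWithin 1 u (Icc a b)) = ‖(fst' z).toCont‖ :=
    supNorm_eq_norm h.d1_eq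
  have h2 : supNorm (Icc a b) (iteratedDerivWithin 2 u (Icc a b)) = ‖(snd' z).toCont‖ :=
    supNorm_eq_norm h.d2_eq
  have h3 : holderSeminorm θ (Icc a b) (iteratedDerivWithin 2 u (Icc a b))
      = (snd' z).holderConst := holderSeminorm_eq h.d2_eq
  rw [cHolderNorm, Finset.sum_range_succ, Finset.sum_range_succ, Finset.sum_range_one, h0, h1, h2,
    h3, norm_def (snd' z), add_assoc _ _ (snd' z).holderConst]

/-- The data consist of u(a), u'(a) and u'', each controlled by one summand of the Hölder norm or by
the last two together. The constant is one, so initial functions in the ε-ball give data in the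
ε-ball. -/
theorem norm_le_cHolderNorm (h : Represents u z) : ‖z‖ ≤ cHolderNorm 2 θ (Icc a b) u := by
  rw [h.cHolderNorm_eq]
  have h0 := (val z).abs_apply_le_norm_toCont (left a b)
  have h1 := (fst' z).abs_apply_le_norm_toCont (left a b)
  rw [val_left] at h0
  rw [fst'_left] at h1
  have h2 := norm_nonneg (val z).toCont
  have h3 := norm_nonneg (fst' z).toCont
  have h4 := norm_nonneg (snd' z)
  refine max_le ?_ (max_le ?_ ?_)
  · rw [Real.norm_eq_abs]; linarith
  · rw [Real.norm_eq_abs]; linarith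
  · change ‖snd' z‖ ≤ _; linarith

end Represents

theorem exists_represents_of_d2_eq {u : ℝ → ℝ} (hc : ContDiffOn ℝ 2 u (Icc a b))
    {w : HolderAlg θ a b} (hw : ∀ x : Icc a b, d2 (Icc a b) u x = w x) :
    ∃ z : C2Data θ a b, Represents u z := by
  refine ⟨(u a, d1 (Icc a b) u a, w), fun x => ?_⟩
  set z : C2Data θ a b := (u a, d1 (Icc a b) u a, w)
  have h1 : ∀ x : Icc a b, d1 (Icc a b) u x = (fst' z) x := fun x => by
    rw [fst'_apply]
    refine eq_primitive_of_hasDerivWithinAt (w := w) (fun y => ?_) x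
    rw [← hw y]
    exact hasDerivWithinAt_d2 hab.out hc le_rfl y.2
  rw [val_apply]
  refine eq_primitive_of_hasDerivWithinAt (fun y => ?_) x
  rw [← h1 y]
  exact hasDerivWithinAt_d1 hc (by norm_num) y.2

theorem exists_represents {u : ℝ → ℝ} (hu : MemCHolder 2 θ (Icc a b) u) :
    ∃ z : C2Data θ a b, Represents u z := by
  obtain ⟨hc, C, hC⟩ := hu
  obtain ⟨w, hw⟩ := exists_holderAlg
    (hc.continuousOn_iteratedDerivWithin le_rfl (uniqueDiffOn_Icc hab.out)) hC
  exact exists_represents_of_d2_eq hc fun x => (hw x).symm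

/-- Functions of class `3` belong to the Hölder space of order `2 + θ`. -/
theorem exists_represents_of_contDiffOn {u : ℝ → ℝ} (hu : ContDiffOn ℝ 3 u (Icc a b)) :
    ∃ z : C2Data θ a b, Represents u z := by
  have hU := uniqueDiffOn_Icc hab.out
  obtain ⟨C, hC⟩ := isCompact_Icc.exists_bound_of_continuousOn
    (hu.continuousOn_iteratedDerivWithin (m := 3) le_rfl hU)
  have hd : ∀ x ∈ Icc a b, HasDerivWithinAt (d2 (Icc a b) u)
      (iteratedDerivWithin 3 u (Icc a b) x) (Icc a b) x := fun x hx => by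
    rw [iteratedDerivWithin_succ]
    exact (hu.differentiableOn_iteratedDerivWithin (m := 2) (by norm_num) hU x hx).hasDerivWithinAt
  have hc : ContinuousOn (d2 (Icc a b) u) (Icc a b) := fun x hx => (hd x hx).continuousWithinAt
  have hC0 : 0 ≤ C := (norm_nonneg _).trans (hC a (left a b).2)
  -- The bounded third derivative makes the second one Lipschitz, hence Hölder on a bounded interval
  -- when θ ≤ 1.
  let w : HolderAlg θ a b :=
    ⟨⟨(Icc a b).domRestrict (d2 (Icc a b) u), hc.domRestrict⟩, C * (b - a) ^ (1 - θ : ℝ),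
      fun x y => by
        rw [mul_assoc]
        exact ((convex_Icc a b).norm_image_sub_le_of_norm_hasDerivWithin_le hd hC y.2 x.2).trans
          (mul_le_mul_of_nonneg_left (abs_sub_le_rpow x y) hC0)⟩
  exact exists_represents_of_d2_eq (hu.of_le (by norm_num)) (w := w) fun x => rfl

/-- The Hölder norm is dominated by the norm of the data. -/
theorem exists_cHolderNorm_le (θ : ℝ≥0) (a b : ℝ) [hab : Fact (a < b)] [hθ : Fact (θ ≤ 1)] :
    ∃ K : ℝ, 0 < K ∧ ∀ (u : ℝ → ℝ) (z : C2Data θ a b), Represents u z →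
      cHolderNorm 2 θ (Icc a b) u ≤ K * ‖z‖ := by
  refine ⟨‖(val : C2Data θ a b →L[ℝ] _)‖ + ‖(fst' : C2Data θ a b →L[ℝ] _)‖ +
    ‖(snd' : C2Data θ a b →L[ℝ] _)‖ + 1, by positivity, fun u z h => ?_⟩
  rw [h.cHolderNorm_eq]
  have h0 := (val z).norm_toCont_le.trans (val.le_opNorm z)
  have h1 := (fst' z).norm_toCont_le.trans (fst'.le_opNorm z)
  have h2 := snd'.le_opNorm z
  linarith [norm_nonneg z]

/-! ### The Dirichlet problem for u'' + p u' + q u with q ≤ 0. -/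

namespace C2Data

/-- The Dirichlet problem for the operator `u'' + p u' + q u`. -/
def dirichletOp (p q : HolderAlg θ a b) : C2Data θ a b →L[ℝ] HolderAlg θ a b × ℝ × ℝ :=
  (snd' + (ContinuousLinearMap.mul ℝ _ p).comp fst' + (ContinuousLinearMap.mul ℝ _ q).comp val).prod
    ((ContinuousLinearMap.fst ℝ ℝ (ℝ × HolderAlg θ a b)).prod ((evalCLM (right a b)).comp val))

theorem dirichletOp_apply (p q : HolderAlg θ a b) (z : C2Data θ a b) :
    dirichletOp p q z = (snd' z + p * fst' z + q * val z, z.1, (val z) (right a b)) := rfl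

/-- A one-dimensional energy argument in place of the maximum principle. With P a primitive of p,
the function e^P u u' has derivative e^P (u'^2 - q u^2) ≥ 0 and vanishes at both ends, so it is
constant and u' = 0. -/
theorem eq_zero_of_dirichletOp_eq_zero {p q : HolderAlg θ a b} (hq : ∀ x, q x ≤ 0)
    {z : C2Data θ a b} (hz : dirichletOp p q z = 0) : z = 0 := by
  rw [dirichletOp_apply, Prod.mk_eq_zero, Prod.mk_eq_zero] at hz
  obtain ⟨hode, hl, hr⟩ := hz
  have hode' : ∀ x, (snd' z) x = -(p x * (fst' z) x) - q x * (val z) x := fun x => by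
    have := congrArg (fun w : HolderAlg θ a b => w x) hode
    simp only [add_apply, mul_apply, zero_apply] at this
    linarith
  let F : ℝ → ℝ := fun x => Real.exp (p.primitive x) * ((val z).extend x * (fst' z).extend x)
  have hF : ∀ x : Icc a b, HasDerivWithinAt F
      (Real.exp (p.primitive x) * ((fst' z) x ^ 2 - q x * (val z) x ^ 2)) (Icc a b) x := by
    intro x
    have h1 := (p.hasDerivAt_primitive x).exp.hasDerivWithinAt (s := Icc a b)
    have h2 := (represents_extend z).hasDerivWithinAt x
    have h3 := Represents.hasDerivWithinAt_fst' z x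
    refine (h1.mul (h2.mul h3)).congr_deriv ?_
    simp only [extend_coe, hode' x, Pi.mul_apply]
    ring
  have hnonneg : ∀ x : Icc a b,
      0 ≤ (fst' z) x ^ 2 - q x * (val z) x ^ 2 := fun x => by
    nlinarith [hq x, sq_nonneg ((fst' z) x), sq_nonneg ((val z) x),
      mul_nonneg (neg_nonneg.2 (hq x)) (sq_nonneg ((val z) x))]
  have hmono : MonotoneOn F (Icc a b) := by
    refine monotoneOn_of_hasDerivWithinAt_nonneg (convex_Icc a b)
      (f' := fun x => derivWithin F (Icc a b) x)
      (fun x hx => (hF ⟨x, hx⟩).continuousWithinAt) (fun x hx => ?_) (fun x hx => ?_)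
    · have hx' := interior_subset hx
      exact ((hF ⟨x, hx'⟩).differentiableWithinAt.hasDerivWithinAt).mono interior_subset
    · have hx' := interior_subset hx
      rw [(hF ⟨x, hx'⟩).derivWithin (uniqueDiffOn_Icc hab.out x hx')]
      exact mul_nonneg (Real.exp_pos _).le (hnonneg ⟨x, hx'⟩)
  have hFa : F a = 0 := by
    have : (val z).extend a = 0 := by
      rw [← hl, ← val_left]; exact extend_coe _ (left a b)
    simp only [F, this, zero_mul, mul_zero]
  have hFb : F b = 0 := by
    have : (val z).extend b = 0 := by
      rw [← hr]; exact extend_coe _ (right a b)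
    simp only [F, this, zero_mul, mul_zero]
  have hF0 : ∀ x ∈ Icc a b, F x = 0 := fun x hx => le_antisymm
    ((hmono hx (right a b).2 hx.2).trans_eq hFb) (hFa.symm.trans_le (hmono (left a b).2 hx hx.1))
  have hfst : ∀ x : Icc a b, (fst' z) x = 0 := fun x => by
    have hU := uniqueDiffOn_Icc hab.out x x.2
    have h1 : HasDerivWithinAt F 0 (Icc a b) x :=
      (hasDerivWithinAt_const _ _ (0 : ℝ)).congr hF0 (hF0 x x.2)
    have h2 := ((hF x).derivWithin hU).symm.trans (h1.derivWithin hU)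
    have h3 := (mul_eq_zero.1 h2).resolve_left (Real.exp_pos _).ne'
    have h4 := mul_nonneg (neg_nonneg.2 (hq x)) (sq_nonneg ((val z) x))
    nlinarith [sq_nonneg ((fst' z) x)]
  have hsnd : snd' z = 0 := by
    ext x
    have hU := uniqueDiffOn_Icc hab.out x x.2
    have h0 : ∀ y ∈ Icc a b, (fst' z).extend y = 0 := fun y hy =>
      (extend_coe _ ⟨y, hy⟩).trans (hfst ⟨y, hy⟩)
    have h1 : HasDerivWithinAt (fst' z).extend 0 (Icc a b) x :=
      (hasDerivWithinAt_const _ _ (0 : ℝ)).congr h0 (h0 x x.2)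
    exact ((Represents.hasDerivWithinAt_fst' z x).derivWithin hU).symm.trans (h1.derivWithin hU)
  exact Prod.ext hl (Prod.ext ((fst'_left z).symm.trans (hfst _)) hsnd)

/-- The initial value problem is solvable. -/
theorem exists_ivp (p q g : HolderAlg θ a b) (c d : ℝ) :
    ∃ z : C2Data θ a b, snd' z + p * fst' z + q * val z = g ∧ z.1 = c ∧ z.2.1 = d := by
  obtain ⟨w, hw⟩ := exists_add_volterra_eq p q
    (g - p * (d • (1 : HolderAlg θ a b)) -
      q * (c • (1 : HolderAlg θ a b) + volterra (d • (1 : HolderAlg θ a b))))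
  refine ⟨(c, d, w), ?_, rfl, rfl⟩
  have h1 : fst' ((c, d, w) : C2Data θ a b) = d • (1 : HolderAlg θ a b) + volterra w := rfl
  have h2 : val ((c, d, w) : C2Data θ a b) =
    c • (1 : HolderAlg θ a b) + volterra (fst' ((c, d, w) : C2Data θ a b)) := rfl
  have h3 : snd' ((c, d, w) : C2Data θ a b) = w := rfl
  rw [h2, h1, map_add, h3]
  linear_combination hw

theorem dirichletOp_bijective {p q : HolderAlg θ a b} (hq : ∀ x, q x ≤ 0) :
    Function.Bijective (dirichletOp p q) := by
  refine ⟨(injective_iff_map_eq_zero _).2 fun z => eq_zero_of_dirichletOp_eq_zero hq, ?_⟩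
  rintro ⟨g, c, d⟩
  obtain ⟨y, hy, hyc, -⟩ := exists_ivp p q g c 0
  -- Shooting: `e` solves the homogeneous equation with zero value and unit slope at the left end.
  -- Uniqueness forbids a zero at the right end, so a multiple of `e` corrects the right boundary
  -- value of `y`.
  obtain ⟨e, he, hec, hed⟩ := exists_ivp p q 0 0 1
  have hne : (val e) (right a b) ≠ 0 := by
    intro h
    have h0 : e = 0 := eq_zero_of_dirichletOp_eq_zero (p := p) hq (by
      rw [dirichletOp_apply, he, hec, h]; rfl)
    rw [h0] at hed
    exact zero_ne_one hed
  refine ⟨y + ((d - (val y) (right a b)) / (val e) (right a b)) • e, ?_⟩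
  rw [map_add, map_smul, dirichletOp_apply, dirichletOp_apply, hy, he, hyc, hec]
  refine Prod.ext (by simp) (Prod.ext (by simp) ?_)
  simp only [Prod.smul_mk, Prod.mk_add_mk, smul_eq_mul]
  field_simp
  ring

/-- The solution operator of the Dirichlet problem. -/
def dirichletEquiv (p : HolderAlg θ a b) {q : HolderAlg θ a b} (hq : ∀ x, q x ≤ 0) :
    C2Data θ a b ≃L[ℝ] HolderAlg θ a b × ℝ × ℝ :=
  ContinuousLinearEquiv.ofBijective (dirichletOp p q)
    (LinearMap.ker_eq_bot.2 (dirichletOp_bijective hq).1)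
    (LinearMap.range_eq_top.2 (dirichletOp_bijective hq).2)

end C2Data

end

end

/-! ### Superlinearity of the nonlinear terms. -/

noncomputable section

theorem rpow_three_halves {t : ℝ} (ht : 0 ≤ t) : t ^ (3 / 2 : ℝ) = Real.sqrt t ^ 3 := by
  rw [Real.sqrt_eq_rpow, ← Real.rpow_natCast, ← Real.rpow_mul ht]
  norm_num

/-- The pointwise expression of `remainder1` in terms of the derivatives of `f` and of `ψ`. -/
def remainderFun (f₀ f₁ f₂ p₀ p₁ p₂ : ℝ) : ℝ :=
  p₂ - 2 * f₁ / f₀ * p₁ + f₂ / f₀ * p₀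
    - 2 * (1 + f₁ ^ 2) ^ (3 / 2 : ℝ) * ((f₂ + p₂) / (2 * (1 + (f₁ + p₁) ^ 2) ^ (3 / 2 : ℝ))
      - 1 / (2 * (f₀ + p₀) * Real.sqrt (1 + (f₁ + p₁) ^ 2)))

/-- Real powers and quotients are traded for a square root, natural powers and inverses, the
operations available in the Hölder algebra. -/
theorem remainderFun_eq (f₀ f₁ f₂ p₀ p₁ p₂ : ℝ) :
    remainderFun f₀ f₁ f₂ p₀ p₁ p₂ = p₂ - 2 * f₁ / f₀ * p₁ + f₂ / f₀ * p₀
      - Real.sqrt (1 + f₁ ^ 2) ^ 3 * ((f₂ + p₂) * (Real.sqrt (1 + (f₁ + p₁) ^ 2))⁻¹ ^ 3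
        - (f₀ + p₀)⁻¹ * (Real.sqrt (1 + (f₁ + p₁) ^ 2))⁻¹) := by
  rw [remainderFun, rpow_three_halves (by positivity), rpow_three_halves (by positivity),
    div_eq_mul_inv (f₂ + p₂), mul_inv, one_div, mul_inv, mul_inv, inv_pow]
  ring

theorem remainderFun_zero {f₀ f₁ f₂ : ℝ} (h₀ : f₀ ≠ 0) (hf : f₀ * f₂ = 1 + f₁ ^ 2) :
    remainderFun f₀ f₁ f₂ 0 0 0 = 0 := by
  have hS : 0 < Real.sqrt (1 + f₁ ^ 2) := Real.sqrt_pos.2 (by positivity)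
  have hS2 : Real.sqrt (1 + f₁ ^ 2) ^ 2 = 1 + f₁ ^ 2 := Real.sq_sqrt (by positivity)
  rw [remainderFun_eq]
  simp only [add_zero]
  set S := Real.sqrt (1 + f₁ ^ 2)
  have h2 : f₂ = S ^ 2 / f₀ := by rw [hS2, ← hf]; field_simp
  rw [h2]
  have := hS.ne'
  field_simp
  ring

/-- The Jacobi operator is the linearisation of 2(1 + f'^2)^(3/2) times the mean curvature at a
minimal meridian. Once f'' = (1 + f'^2)/f is inserted, the two contributions -3f'/f and f'/f to the
coefficient of p₁ add up to -2f'/f. -/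
theorem hasDerivAt_remainderFun {f₀ f₁ f₂ : ℝ} (h₀ : f₀ ≠ 0) (hf : f₀ * f₂ = 1 + f₁ ^ 2)
    (p₀ p₁ p₂ : ℝ) :
    HasDerivAt (fun t : ℝ => remainderFun f₀ f₁ f₂ (t * p₀) (t * p₁) (t * p₂)) 0 0 := by
  have hS : 0 < Real.sqrt (1 + f₁ ^ 2) := Real.sqrt_pos.2 (by positivity)
  have hS2 : Real.sqrt (1 + f₁ ^ 2) ^ 2 = 1 + f₁ ^ 2 := Real.sq_sqrt (by positivity)
  simp only [remainderFun_eq]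
  have d (c : ℝ) : HasDerivAt (fun t : ℝ => t * c) c 0 := by
    simpa using (hasDerivAt_id (0 : ℝ)).mul_const c
  have dW : HasDerivAt (fun t : ℝ => Real.sqrt (1 + (f₁ + t * p₁) ^ 2))
      (f₁ * p₁ / Real.sqrt (1 + f₁ ^ 2)) 0 := by
    have h := ((((d p₁).const_add f₁).fun_pow 2).const_add 1).sqrt (by positivity)
    refine h.congr_deriv ?_
    simp only [zero_mul, add_zero]
    field_simp
    norm_num
    ring
  have hW0 : Real.sqrt (1 + (f₁ + 0 * p₁) ^ 2) ≠ 0 := by simpa using hS.ne'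
  have dWi := dW.fun_inv hW0
  have dF := ((d p₀).const_add f₀).fun_inv (by simpa using h₀)
  have key := (((d p₂).sub ((d p₁).const_mul (2 * f₁ / f₀))).add ((d p₀).const_mul (f₂ / f₀))).sub
    (((((d p₂).const_add f₂).mul (dWi.fun_pow 3)).sub (dF.mul dWi)).const_mul
      (Real.sqrt (1 + f₁ ^ 2) ^ 3))
  refine key.congr_deriv ?_
  simp only [zero_mul, add_zero, inv_pow, Nat.add_one_sub_one, Nat.cast_ofNat]
  set S := Real.sqrt (1 + f₁ ^ 2)
  have h2 : f₂ = S ^ 2 / f₀ := by rw [hS2, ← hf]; field_simp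
  rw [h2]
  have := hS.ne'
  field_simp
  ring

/-- The pointwise expression of the right-hand side of the equation for the mean curvature;
`κ` stands for `2 * α / β`. -/
def curvatureRhsFun (κ f₀ f₁ f₂ p₀ p₁ p₂ h₀ h₁ h₂ : ℝ) : ℝ :=
  h₂ + 2 * f₂ / f₀ * h₀ - κ * (1 + f₁ ^ 2) * h₀
    - (h₂ + (f₁ + p₁) * (1 / (f₀ + p₀) - (f₂ + p₂) / (1 + (f₁ + p₁) ^ 2)) * h₁
      + 2 * h₀ ^ 3 * (1 + (f₁ + p₁) ^ 2) + 2 * ((f₂ + p₂) / (f₀ + p₀)) * h₀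
      - κ * (1 + (f₁ + p₁) ^ 2) * h₀)

theorem curvatureRhsFun_zero (κ f₀ f₁ f₂ p₀ p₁ p₂ : ℝ) :
    curvatureRhsFun κ f₀ f₁ f₂ p₀ p₁ p₂ 0 0 0 = 0 := by
  simp [curvatureRhsFun]

theorem hasDerivAt_curvatureRhsFun (κ : ℝ) {f₀ f₁ f₂ : ℝ} (hf₀ : f₀ ≠ 0)
    (hf : f₀ * f₂ = 1 + f₁ ^ 2) (p₀ p₁ p₂ h₀ h₁ h₂ : ℝ) :
    HasDerivAt (fun t : ℝ => curvatureRhsFun κ f₀ f₁ f₂ (t * p₀) (t * p₁) (t * p₂)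
      (t * h₀) (t * h₁) (t * h₂)) 0 0 := by
  -- Each term contains the curvature or one of its derivatives, so a factor t splits off. At t = 0
  -- all that survives in `k` is -f₁ (1/f₀ - f₂/(1 + f₁^2)) h₁, which the minimal surface equation
  -- annihilates.
  let k : ℝ → ℝ := fun t => h₂ + 2 * f₂ / f₀ * h₀ - κ * (1 + f₁ ^ 2) * h₀
    - (h₂ + (f₁ + t * p₁) * (1 / (f₀ + t * p₀) - (f₂ + t * p₂) / (1 + (f₁ + t * p₁) ^ 2)) * h₁
      + 2 * t ^ 2 * h₀ ^ 3 * (1 + (f₁ + t * p₁) ^ 2)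
      + 2 * ((f₂ + t * p₂) / (f₀ + t * p₀)) * h₀ - κ * (1 + (f₁ + t * p₁) ^ 2) * h₀)
  have hk : DifferentiableAt ℝ k 0 := by
    have h1 : f₀ + 0 * p₀ ≠ 0 := by simpa using hf₀
    have h2 : 1 + (f₁ + 0 * p₁) ^ 2 ≠ 0 := by positivity
    fun_prop (disch := assumption)
  have hk0 : k 0 = 0 := by
    have h2 : f₂ = (1 + f₁ ^ 2) / f₀ := by rw [← hf]; field_simp
    have h3 : 1 + f₁ ^ 2 ≠ 0 := by positivity
    simp only [k, zero_mul, add_zero]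
    rw [h2]
    field_simp
    ring
  have h' : HasDerivAt (fun t : ℝ => t * k t) 0 0 :=
    ((hasDerivAt_id (0 : ℝ)).fun_mul hk.hasDerivAt).congr_deriv (by simp [hk0])
  refine h'.congr_of_eventuallyEq (Eventually.of_forall fun t => ?_)
  simp only [curvatureRhsFun, k]
  ring

variable {θ : ℝ≥0} {a b : ℝ} {Z : Type*} [NormedAddCommGroup Z] [NormedSpace ℝ Z]

/-- A differentiable map into the Hölder space whose pointwise derivatives at zero vanish is
superlinear. -/
theorem exists_norm_le_of_pointwise {N : Z → HolderAlg θ a b} {G : Z → Icc a b → ℝ}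
    (hN : DifferentiableAt ℝ N 0) (hNG : ∀ᶠ z in 𝓝 0, ∀ x, N z x = G z x) (hG : ∀ x, G 0 x = 0)
    (hG' : ∀ z x, HasDerivAt (fun t : ℝ => G (t • z) x) 0 0) {c : ℝ} (hc : 0 < c) :
    ∀ᶠ z in 𝓝 0, ‖N z‖ ≤ c * ‖z‖ := by
  have hN0 : N 0 = 0 := HolderAlg.ext fun x => (hNG.self_of_nhds x).trans (hG x)
  -- Evaluation at x is continuous and linear, so the derivative of `N` in direction z, evaluated at
  -- x, is the derivative of a real function of t, which is zero by hypothesis.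
  have hfd : fderiv ℝ N 0 = 0 := by
    refine ContinuousLinearMap.ext fun z => HolderAlg.ext fun x => ?_
    have hl : HasDerivAt (fun t : ℝ => t • z) z 0 := by
      simpa using (hasDerivAt_id (0 : ℝ)).smul_const z
    have hN' : HasFDerivAt N (fderiv ℝ N 0) ((0 : ℝ) • z) := by
      rw [zero_smul]; exact hN.hasFDerivAt
    have h1 : HasDerivAt (fun t : ℝ => N (t • z) x) ((fderiv ℝ N 0 z) x) 0 :=
      (HolderAlg.evalCLM x).hasFDerivAt.comp_hasDerivAt 0 (hN'.comp_hasDerivAt 0 hl)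
    have ht : Tendsto (fun t : ℝ => t • z) (𝓝 0) (𝓝 0) := by
      simpa using hl.continuousAt.tendsto
    have h2 : HasDerivAt (fun t : ℝ => N (t • z) x) 0 0 :=
      (hG' z x).congr_of_eventuallyEq ((ht.eventually hNG).mono fun t h => h x)
    exact h1.unique h2
  have h := hN.hasFDerivAt
  rw [hfd] at h
  have h3 := h.isLittleO.bound hc
  filter_upwards [h3] with z hz
  simpa [hN0] using hz

open HolderAlg

/-- The pointwise formula is realised by algebra operations and the local square root `R`; the
formula and `N` agree only where `R` is the root and the perturbed meridian is invertible, hence the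
restriction to a neighbourhood of 0. -/
theorem exists_remainder [hab : Fact (a < b)] {F₀ F₁ F₂ : HolderAlg θ a b}
    (hF : ∀ x, F₀ x ≠ 0) (hmin : ∀ x, F₀ x * F₂ x = 1 + F₁ x ^ 2)
    (ψ₀ ψ₁ ψ₂ : Z →L[ℝ] HolderAlg θ a b) :
    ∃ N : Z → HolderAlg θ a b,
      (∀ᶠ z in 𝓝 0, ∀ x, N z x
        = remainderFun (F₀ x) (F₁ x) (F₂ x) (ψ₀ z x) (ψ₁ z x) (ψ₂ z x)) ∧
      ∀ c : ℝ, 0 < c → ∀ᶠ z in 𝓝 0, ‖N z‖ ≤ c * ‖z‖ := by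
  obtain ⟨S, hS⟩ := exists_sqrt (u := 1 + F₁ * F₁) fun x => by
    exact add_pos_of_pos_of_nonneg one_pos (mul_self_nonneg (F₁ x))
  have hS' : ∀ x, S x = Real.sqrt (1 + F₁ x ^ 2) := fun x => by
    rw [hS, sq]; rfl
  have hSpos : ∀ x, 0 < S x := fun x => by
    rw [hS']; exact Real.sqrt_pos.2 (by positivity)
  have hSS : S * S = 1 + F₁ * F₁ := by
    ext x
    rw [HolderAlg.mul_apply, hS]
    exact Real.mul_self_sqrt (add_nonneg zero_le_one (mul_self_nonneg (F₁ x)))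
  obtain ⟨R, hRd, hR0, hR⟩ := exists_differentiableAt_sqrt hSpos
  have hF₀ : IsUnit F₀ := isUnit_of_forall_ne_zero hF
  have hSu : IsUnit S := isUnit_of_forall_ne_zero fun x => (hSpos x).ne'
  let w : Z → HolderAlg θ a b := fun z => 1 + (F₁ + ψ₁ z) * (F₁ + ψ₁ z)
  have hw0 : w 0 = S * S := by simp only [w, map_zero, add_zero, hSS]
  have hwd : DifferentiableAt ℝ w 0 := by fun_prop
  have hRw : DifferentiableAt ℝ (fun z => R (w z)) 0 := by
    refine DifferentiableAt.comp (g := R) (f := w) (0 : Z) ?_ hwd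
    rw [hw0]; exact hRd
  have hRw0 : R (w 0) = S := by rw [hw0, hR0]
  have hi : DifferentiableAt ℝ (fun z => Ring.inverse (R (w z))) 0 := by
    refine DifferentiableAt.comp (g := Ring.inverse) (f := fun z => R (w z)) (0 : Z) ?_ hRw
    rw [hRw0]; exact differentiableAt_inverse hSu
  have hj : DifferentiableAt ℝ (fun z => Ring.inverse (F₀ + ψ₀ z)) 0 := by
    refine DifferentiableAt.comp (g := Ring.inverse) (f := fun z => F₀ + ψ₀ z) (0 : Z) ?_
      (by fun_prop)
    rw [map_zero, add_zero]; exact differentiableAt_inverse hF₀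
  let N : Z → HolderAlg θ a b := fun z =>
    ψ₂ z - (2 : ℝ) • (F₁ * Ring.inverse F₀ * ψ₁ z) + F₂ * Ring.inverse F₀ * ψ₀ z
      - S ^ 3 * ((F₂ + ψ₂ z) * Ring.inverse (R (w z)) ^ 3
        - Ring.inverse (F₀ + ψ₀ z) * Ring.inverse (R (w z)))
  have hN : DifferentiableAt ℝ N 0 := by fun_prop
  have hev : ∀ᶠ z in 𝓝 0, ∀ x, N z x
      = remainderFun (F₀ x) (F₁ x) (F₂ x) (ψ₀ z x) (ψ₁ z x) (ψ₂ z x) := by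
    have e1 : ∀ᶠ z in 𝓝 (0 : Z), IsUnit (F₀ + ψ₀ z) := by
      have hc : Tendsto (fun z : Z => F₀ + ψ₀ z) (𝓝 0) (𝓝 F₀) := by
        have : Continuous fun z : Z => F₀ + ψ₀ z := by fun_prop
        simpa using this.tendsto 0
      exact hc.eventually (Units.isOpen.mem_nhds hF₀)
    have e2 := hwd.continuousAt.tendsto.eventually (hw0 ▸ hR)
    filter_upwards [e1, e2] with z h1 h2 x
    have h3 : IsUnit (R (w z)) := isUnit_of_forall_ne_zero fun x => (h2 x).1.ne'
    have h4 : R (w z) x = Real.sqrt (1 + (F₁ x + ψ₁ z x) ^ 2) := by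
      rw [(h2 x).2, sq]; rfl
    rw [remainderFun_eq]
    simp only [N, HolderAlg.add_apply, HolderAlg.sub_apply, HolderAlg.mul_apply, HolderAlg.smul_apply, HolderAlg.pow_apply, inverse_apply h1,
      inverse_apply h3, inverse_apply hF₀, hS', h4]
    ring
  refine ⟨N, hev, fun c hc => exists_norm_le_of_pointwise hN hev (fun x => ?_)
    (fun z x => ?_) hc⟩
  · simp only [map_zero, HolderAlg.zero_apply]
    exact remainderFun_zero (hF x) (hmin x)
  · simp only [map_smul, HolderAlg.smul_apply]
    exact hasDerivAt_remainderFun (hF x) (hmin x) _ _ _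

theorem exists_curvatureRhs (κ : ℝ) {F₀ F₁ F₂ : HolderAlg θ a b}
    (hF : ∀ x, F₀ x ≠ 0) (hmin : ∀ x, F₀ x * F₂ x = 1 + F₁ x ^ 2)
    (ψ₀ ψ₁ ψ₂ h₀ h₁ h₂ : Z →L[ℝ] HolderAlg θ a b) :
    ∃ N : Z → HolderAlg θ a b,
      (∀ᶠ z in 𝓝 0, ∀ x, N z x
        = curvatureRhsFun κ (F₀ x) (F₁ x) (F₂ x) (ψ₀ z x) (ψ₁ z x) (ψ₂ z x)
          (h₀ z x) (h₁ z x) (h₂ z x)) ∧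
      ∀ c : ℝ, 0 < c → ∀ᶠ z in 𝓝 0, ‖N z‖ ≤ c * ‖z‖ := by
  have hF₀ : IsUnit F₀ := isUnit_of_forall_ne_zero hF
  let w : Z → HolderAlg θ a b := fun z => 1 + (F₁ + ψ₁ z) ^ 2
  have hwu : ∀ z, IsUnit (w z) := fun z => isUnit_of_forall_ne_zero fun x => by
    simp only [w, HolderAlg.add_apply, HolderAlg.one_apply, HolderAlg.pow_apply]; positivity
  have hwd : DifferentiableAt ℝ w 0 := by fun_prop
  have hi : DifferentiableAt ℝ (fun z => Ring.inverse (w z)) 0 :=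
    DifferentiableAt.comp (g := Ring.inverse) (f := w) (0 : Z)
      (differentiableAt_inverse (hwu 0)) hwd
  have hj : DifferentiableAt ℝ (fun z => Ring.inverse (F₀ + ψ₀ z)) 0 := by
    refine DifferentiableAt.comp (g := Ring.inverse) (f := fun z => F₀ + ψ₀ z) (0 : Z) ?_
      (by fun_prop)
    rw [map_zero, add_zero]; exact differentiableAt_inverse hF₀
  let N : Z → HolderAlg θ a b := fun z =>
    h₂ z + (2 : ℝ) • (F₂ * Ring.inverse F₀ * h₀ z) - κ • ((1 + F₁ ^ 2) * h₀ z)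
      - (h₂ z + (F₁ + ψ₁ z) * (Ring.inverse (F₀ + ψ₀ z)
          - (F₂ + ψ₂ z) * Ring.inverse (w z)) * h₁ z
        + (2 : ℝ) • (h₀ z ^ 3 * w z)
        + (2 : ℝ) • ((F₂ + ψ₂ z) * Ring.inverse (F₀ + ψ₀ z) * h₀ z) - κ • (w z * h₀ z))
  have hN : DifferentiableAt ℝ N 0 := by fun_prop
  have hev : ∀ᶠ z in 𝓝 0, ∀ x, N z x
      = curvatureRhsFun κ (F₀ x) (F₁ x) (F₂ x) (ψ₀ z x) (ψ₁ z x) (ψ₂ z x)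
        (h₀ z x) (h₁ z x) (h₂ z x) := by
    have e1 : ∀ᶠ z in 𝓝 (0 : Z), IsUnit (F₀ + ψ₀ z) := by
      have hc : Tendsto (fun z : Z => F₀ + ψ₀ z) (𝓝 0) (𝓝 F₀) := by
        have : Continuous fun z : Z => F₀ + ψ₀ z := by fun_prop
        simpa using this.tendsto 0
      exact hc.eventually (Units.isOpen.mem_nhds hF₀)
    filter_upwards [e1] with z h1 x
    simp only [N, HolderAlg.add_apply, HolderAlg.sub_apply, HolderAlg.mul_apply, HolderAlg.smul_apply, HolderAlg.pow_apply, HolderAlg.one_apply,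
      inverse_apply h1, inverse_apply (hwu z), inverse_apply hF₀, curvatureRhsFun]
    simp only [w, HolderAlg.add_apply, HolderAlg.one_apply, HolderAlg.pow_apply]
    ring
  refine ⟨N, hev, fun c hc => exists_norm_le_of_pointwise hN hev (fun x => ?_)
    (fun z x => ?_) hc⟩
  · simp only [map_zero, HolderAlg.zero_apply]
    exact curvatureRhsFun_zero _ _ _ _ _ _ _
  · simp only [map_smul, HolderAlg.smul_apply]
    exact hasDerivAt_curvatureRhsFun κ (hF x) (hmin x) _ _ _ _ _ _

end

/-! ### One step of the successive approximation. -/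

noncomputable section

open HolderAlg C2Data

variable {θ : ℝ≥0} {a b : ℝ} [hab : Fact (a < b)] [hθ : Fact (θ ≤ 1)]

/-- `u` and its first two derivatives on `[a, b]` are `u₀`, `u₁`, `u₂`. -/
structure HasJet (u : ℝ → ℝ) (u₀ u₁ u₂ : HolderAlg θ a b) : Prop where
  eq : ∀ x : Icc a b, u x = u₀ x
  deriv₁ : ∀ x : Icc a b, HasDerivWithinAt u₀.extend (u₁ x) (Icc a b) x
  deriv₂ : ∀ x : Icc a b, HasDerivWithinAt u₁.extend (u₂ x) (Icc a b) x

theorem Represents.hasJet {u : ℝ → ℝ} {z : C2Data θ a b} (h : Represents u z) :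
    HasJet u (val z) (fst' z) (snd' z) :=
  ⟨h, (represents_extend z).hasDerivWithinAt, Represents.hasDerivWithinAt_fst' z⟩

namespace HasJet

variable {θ : ℝ≥0} {a b : ℝ} [hab : Fact (a < b)] {u v : ℝ → ℝ}
  {u₀ u₁ u₂ v₀ v₁ v₂ : HolderAlg θ a b}

theorem hasDerivWithinAt (h : HasJet u u₀ u₁ u₂) (x : ℝ) (hx : x ∈ Icc a b) :
    HasDerivWithinAt u (u₁.extend x) (Icc a b) x := by
  rw [extend_coe u₁ ⟨x, hx⟩]
  exact (h.deriv₁ ⟨x, hx⟩).congr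
    (fun y hy => (h.eq ⟨y, hy⟩).trans (extend_coe u₀ ⟨y, hy⟩).symm)
    ((h.eq ⟨x, hx⟩).trans (extend_coe u₀ ⟨x, hx⟩).symm)

theorem d1_eq (h : HasJet u u₀ u₁ u₂) (x : Icc a b) : d1 (Icc a b) u x = u₁ x := by
  rw [d1_eq_of_hasDerivWithinAt hab.out x.2 (h.hasDerivWithinAt x x.2), extend_coe]

theorem d2_eq (h : HasJet u u₀ u₁ u₂) (x : Icc a b) : d2 (Icc a b) u x = u₂ x := by
  rw [← extend_coe u₂]
  refine d2_eq_of_hasDerivWithinAt hab.out h.hasDerivWithinAt x.2 ?_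
  rw [extend_coe]
  exact h.deriv₂ x

theorem add (hu : HasJet u u₀ u₁ u₂) (hv : HasJet v v₀ v₁ v₂) :
    HasJet (fun x => u x + v x) (u₀ + v₀) (u₁ + v₁) (u₂ + v₂) :=
  ⟨fun x => congrArg₂ (· + ·) (hu.eq x) (hv.eq x), fun x => (hu.deriv₁ x).add (hv.deriv₁ x),
    fun x => (hu.deriv₂ x).add (hv.deriv₂ x)⟩

theorem mul (hu : HasJet u u₀ u₁ u₂) (hv : HasJet v v₀ v₁ v₂) :
    HasJet (fun x => u x * v x) (u₀ * v₀) (u₁ * v₀ + u₀ * v₁)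
      (u₂ * v₀ + (2 : ℝ) • (u₁ * v₁) + u₀ * v₂) := by
  refine ⟨fun x => congrArg₂ (· * ·) (hu.eq x) (hv.eq x), fun x => ?_, fun x => ?_⟩
  · refine ((hu.deriv₁ x).mul (hv.deriv₁ x)).congr_deriv ?_
    simp only [extend_coe, HolderAlg.add_apply, HolderAlg.mul_apply]
  · refine (((hu.deriv₂ x).mul (hv.deriv₁ x)).add
      ((hu.deriv₁ x).mul (hv.deriv₂ x))).congr_deriv ?_
    simp only [extend_coe, HolderAlg.add_apply, HolderAlg.mul_apply, HolderAlg.smul_apply]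
    ring

end HasJet

/-- The product with `χ`, as a linear map, and its first two derivatives. -/
def mulJet₀ (y : C2Data θ a b) : C2Data θ a b →L[ℝ] HolderAlg θ a b :=
  ((ContinuousLinearMap.mul ℝ (HolderAlg θ a b)).flip (val y)).comp val

/-- The first derivative of the product. -/
def mulJet₁ (y : C2Data θ a b) : C2Data θ a b →L[ℝ] HolderAlg θ a b :=
  ((ContinuousLinearMap.mul ℝ (HolderAlg θ a b)).flip (val y)).comp fst' +
    ((ContinuousLinearMap.mul ℝ (HolderAlg θ a b)).flip (fst' y)).comp val

/-- The second derivative of the product. -/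
def mulJet₂ (y : C2Data θ a b) : C2Data θ a b →L[ℝ] HolderAlg θ a b :=
  ((ContinuousLinearMap.mul ℝ (HolderAlg θ a b)).flip (val y)).comp snd' +
    (2 : ℝ) • ((ContinuousLinearMap.mul ℝ (HolderAlg θ a b)).flip (fst' y)).comp fst' +
    ((ContinuousLinearMap.mul ℝ (HolderAlg θ a b)).flip (snd' y)).comp val

theorem Represents.hasJet_mul {φ χ : ℝ → ℝ} {z y : C2Data θ a b} (hφ : Represents φ z)
    (hχ : Represents χ y) :
    HasJet (fun x => φ x * χ x) (mulJet₀ y z) (mulJet₁ y z) (mulJet₂ y z) :=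
  hφ.hasJet.mul hχ.hasJet

/-- Unique solvability of a Dirichlet problem whose operator is represented by `dirichletOp`. -/
theorem uniqueDirichletSol {L : (ℝ → ℝ) → ℝ → ℝ} {p q : HolderAlg θ a b} (hq : ∀ x, q x ≤ 0)
    (hL : ∀ (u : ℝ → ℝ) (z : C2Data θ a b), Represents u z →
      ∀ x : Icc a b, L u x = (snd' z + p * fst' z + q * val z) x)
    {g : ℝ → ℝ} {G : HolderAlg θ a b} (hg : ∀ x : Icc a b, g x = G x) {u : ℝ → ℝ}
    (hu : Represents u ((dirichletEquiv p hq).symm (G, 0, 0))) :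
    UniqueDirichletSol θ a b L g u := by
  set y := (dirichletEquiv p hq).symm (G, 0, 0) with hy
  have h1 : (snd' y + p * fst' y + q * val y, y.1, (val y) (right a b)) = (G, (0 : ℝ), (0 : ℝ)) :=
    (dirichletEquiv p hq).apply_symm_apply (G, 0, 0)
  simp only [Prod.mk.injEq] at h1
  obtain ⟨h1, h2, h3⟩ := h1
  refine ⟨⟨hu.memCHolder, fun x hx => ?_, ?_, ?_⟩, fun v hv => ?_⟩
  · rw [hL u y hu ⟨x, hx⟩, h1, hg ⟨x, hx⟩]
  · rw [← h2, ← val_left]; exact hu (left a b)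
  · rw [← h3]; exact hu (right a b)
  · obtain ⟨hvm, hvL, hva, hvb⟩ := hv
    obtain ⟨z, hz⟩ := exists_represents hvm
    have hzy : z = y := by
      rw [hy, ContinuousLinearEquiv.eq_symm_apply]
      change (snd' z + p * fst' z + q * val z, z.1, (val z) (right a b)) = _
      refine Prod.ext (HolderAlg.ext fun x => ?_) (Prod.ext ?_ ?_)
      · exact (hL v z hz x).symm.trans ((hvL x x.2).trans (hg x))
      · exact (val_left z).symm.trans ((hz (left a b)).symm.trans hva)
      · exact (hz (right a b)).symm.trans hvb
    intro x hx
    exact (hz ⟨x, hx⟩).trans ((congrArg (fun z => (val z) ⟨x, hx⟩) hzy).trans (hu ⟨x, hx⟩).symm)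

set_option maxHeartbeats 1000000 in
/-- Near zero, one step of the successive approximation is uniquely solvable, and it makes the norm
as small a multiple of the old one as desired. -/
theorem exists_approximation_step {α β : ℝ} {f χ : ℝ → ℝ}
    {zf zχ : C2Data θ a b} (hzf : Represents f zf) (hzχ : Represents χ zχ)
    (hpos : ∀ x ∈ Icc a b, 0 < f x) (hmin : MinimalSurfaceEq (Icc a b) f)
    (hχ : ∀ x ∈ Icc a b, 0 < χ x) (hJ : ∀ x ∈ Icc a b, jacobiOp (Icc a b) f χ x ≤ 0)
    (hcond : ∀ x ∈ Icc a b, 1 / f x ^ 2 < α / β) {η : ℝ} (hη : 0 < η) :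
    ∀ᶠ w : C2Data θ a b × C2Data θ a b in 𝓝 0,
      ∃ w' : C2Data θ a b × C2Data θ a b, ‖w'‖ ≤ η * ‖w‖ ∧
        ∀ φ H φ' H' : ℝ → ℝ, Represents φ w.1 → Represents H w.2 →
          Represents φ' w'.1 → Represents H' w'.2 →
          UniqueDirichletSol θ a b (opL2 α β (Icc a b) f) (rhs2 α β (Icc a b) f χ φ H) H' ∧
          UniqueDirichletSol θ a b (opL1 (Icc a b) f χ) (rhs1 (Icc a b) f χ φ H') φ' := by
  set F₀ := val zf with hF₀
  set F₁ := fst' zf with hF₁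
  set F₂ := snd' zf with hF₂
  set C₀ := val zχ with hC₀
  set C₁ := fst' zχ with hC₁
  set C₂ := snd' zχ with hC₂
  set κ := 2 * α / β with hκ
  have eF₀ : ∀ x : Icc a b, f x = F₀ x := hzf
  have eF₁ : ∀ x : Icc a b, d1 (Icc a b) f x = F₁ x := hzf.d1_eq
  have eF₂ : ∀ x : Icc a b, d2 (Icc a b) f x = F₂ x := hzf.d2_eq
  have eC₀ : ∀ x : Icc a b, χ x = C₀ x := hzχ
  have eC₁ : ∀ x : Icc a b, d1 (Icc a b) χ x = C₁ x := hzχ.d1_eq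
  have eC₂ : ∀ x : Icc a b, d2 (Icc a b) χ x = C₂ x := hzχ.d2_eq
  have hF0 : ∀ x, 0 < F₀ x := fun x => by rw [← eF₀]; exact hpos x x.2
  have hC0 : ∀ x, 0 < C₀ x := fun x => by rw [← eC₀]; exact hχ x x.2
  have hFm : ∀ x, F₀ x * F₂ x = 1 + F₁ x ^ 2 := fun x => by
    rw [← eF₀, ← eF₁, ← eF₂]; exact hmin x x.2
  have hFu : IsUnit F₀ := isUnit_of_forall_ne_zero fun x => (hF0 x).ne'
  have hCu : IsUnit C₀ := isUnit_of_forall_ne_zero fun x => (hC0 x).ne'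
  set iF := Ring.inverse F₀
  set iC := Ring.inverse C₀
  have hiF : ∀ x, iF x = (F₀ x)⁻¹ := inverse_apply hFu
  have hiC : ∀ x, iC x = (C₀ x)⁻¹ := inverse_apply hCu
  let p₁ : HolderAlg θ a b := (2 : ℝ) • (C₁ * iC - F₁ * iF)
  let q₁ : HolderAlg θ a b := C₂ * iC - (2 : ℝ) • (F₁ * C₁ * iF * iC) + F₂ * iF
  let q₂ : HolderAlg θ a b := (2 : ℝ) • (F₂ * iF) - κ • (1 + F₁ ^ 2)
  have hq₁ : ∀ x, q₁ x ≤ 0 := fun x => by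
    have h1 := hJ x x.2
    rw [jacobiOp, eF₀, eF₁, eF₂, eC₀, eC₁, eC₂] at h1
    -- The zeroth-order coefficient is the Jacobi operator applied to `χ`, divided by `χ`; stability
    -- gives its sign.
    have h2 : q₁ x = (C₂ x - 2 * F₁ x / F₀ x * C₁ x + F₂ x / F₀ x * C₀ x) * (C₀ x)⁻¹ := by
      simp only [q₁, HolderAlg.add_apply, HolderAlg.sub_apply, HolderAlg.mul_apply,
        HolderAlg.smul_apply, hiF, hiC]
      have := (hF0 x).ne'
      have := (hC0 x).ne'
      field_simp
    rw [h2]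
    exact mul_nonpos_of_nonpos_of_nonneg h1 (inv_nonneg.2 (hC0 x).le)
  have hq₂ : ∀ x, q₂ x ≤ 0 := fun x => by
    have h1 := hcond x x.2
    rw [eF₀] at h1
    -- Substituting f'' = (1 + f'^2)/f exposes the sign condition 1/f^2 < α/β.
    have h2 : q₂ x = 2 * (1 + F₁ x ^ 2) * (1 / F₀ x ^ 2 - α / β) := by
      simp only [q₂, HolderAlg.add_apply, HolderAlg.sub_apply, HolderAlg.mul_apply,
        HolderAlg.smul_apply, HolderAlg.pow_apply, HolderAlg.one_apply, hiF]
      have h3 : F₂ x = (1 + F₁ x ^ 2) / F₀ x := by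
        rw [← hFm]; have := (hF0 x).ne'; field_simp
      rw [h3, hκ]
      ring
    rw [h2]
    exact mul_nonpos_of_nonneg_of_nonpos (by positivity) (by linarith)
  have hL₁ : ∀ (u : ℝ → ℝ) (z : C2Data θ a b), Represents u z → ∀ x : Icc a b,
      opL1 (Icc a b) f χ u x = (snd' z + p₁ * fst' z + q₁ * val z) x := fun u z hu x => by
    rw [opL1, hu.d1_eq, hu.d2_eq, hu x, eF₀, eF₁, eF₂, eC₀, eC₁, eC₂]
    simp only [p₁, q₁, HolderAlg.add_apply, HolderAlg.sub_apply, HolderAlg.mul_apply,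
      HolderAlg.smul_apply, hiF, hiC]
    ring
  have hL₂ : ∀ (u : ℝ → ℝ) (z : C2Data θ a b), Represents u z → ∀ x : Icc a b,
      opL2 α β (Icc a b) f u x = (snd' z + 0 * fst' z + q₂ * val z) x := fun u z hu x => by
    rw [opL2, hu.d2_eq, hu x, eF₀, eF₁, eF₂, ← hκ]
    simp only [q₂, HolderAlg.add_apply, HolderAlg.sub_apply, HolderAlg.mul_apply,
      HolderAlg.smul_apply, HolderAlg.pow_apply, HolderAlg.one_apply, HolderAlg.zero_apply, hiF]
    ring
  obtain ⟨S, hS⟩ := exists_sqrt (u := 1 + F₁ ^ 2) fun x => by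
    simp only [HolderAlg.add_apply, HolderAlg.one_apply, HolderAlg.pow_apply]; positivity
  let G : HolderAlg θ a b := (2 : ℝ) • (S ^ 3 * iC)
  have hG : ∀ x, G x = 2 * (1 + F₁ x ^ 2) ^ (3 / 2 : ℝ) / C₀ x := fun x => by
    rw [rpow_three_halves (by positivity)]
    simp only [G, HolderAlg.smul_apply, HolderAlg.mul_apply, HolderAlg.pow_apply, hS, hiC,
      HolderAlg.add_apply, HolderAlg.one_apply]
    ring
  let π₁ := ContinuousLinearMap.fst ℝ (C2Data θ a b) (C2Data θ a b)
  let π₂ := ContinuousLinearMap.snd ℝ (C2Data θ a b) (C2Data θ a b)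
  obtain ⟨N₁, hN₁, hN₁'⟩ := exists_remainder (fun x => (hF0 x).ne') hFm
    ((mulJet₀ zχ).comp π₁) ((mulJet₁ zχ).comp π₁) ((mulJet₂ zχ).comp π₁)
  obtain ⟨N₂, hN₂, hN₂'⟩ := exists_curvatureRhs κ (fun x => (hF0 x).ne') hFm
    ((mulJet₀ zχ).comp π₁) ((mulJet₁ zχ).comp π₁) ((mulJet₂ zχ).comp π₁)
    (val.comp π₂) (fst'.comp π₂) (snd'.comp π₂)
  let T₁ : HolderAlg θ a b →L[ℝ] C2Data θ a b :=
    ((dirichletEquiv p₁ hq₁).symm : _ →L[ℝ] C2Data θ a b).comp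
      (ContinuousLinearMap.inl ℝ (HolderAlg θ a b) (ℝ × ℝ))
  let T₂ : HolderAlg θ a b →L[ℝ] C2Data θ a b :=
    ((dirichletEquiv 0 hq₂).symm : _ →L[ℝ] C2Data θ a b).comp
      (ContinuousLinearMap.inl ℝ (HolderAlg θ a b) (ℝ × ℝ))
  -- `D` bounds the amplification by both solution operators and by the coefficient `G` of the
  -- curvature; the nonlinear terms are therefore required to be at most η/D times the norm of w.
  set D := ‖T₂‖ + ‖T₁‖ * (‖G‖ * (‖(val : C2Data θ a b →L[ℝ] _)‖ * ‖T₂‖) + ‖iC‖) + 1 with hD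
  have hD1 : 0 ≤ ‖T₁‖ * (‖G‖ * (‖(val : C2Data θ a b →L[ℝ] _)‖ * ‖T₂‖) + ‖iC‖) :=
    mul_nonneg (norm_nonneg _) (add_nonneg (mul_nonneg (norm_nonneg _)
      (mul_nonneg (norm_nonneg _) (norm_nonneg _))) (norm_nonneg _))
  have hD0 : 0 < D :=
    add_pos_of_nonneg_of_pos (add_nonneg (norm_nonneg _) hD1) one_pos
  have hc : 0 < η / D := div_pos hη hD0
  filter_upwards [hN₁, hN₂, hN₁' _ hc, hN₂' _ hc] with w e1 e2 b1 b2
  set h' := T₂ (N₂ w) with hh'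
  have bh : ‖h'‖ ≤ ‖T₂‖ * (η / D * ‖w‖) :=
    (T₂.le_opNorm _).trans (mul_le_mul_of_nonneg_left b2 (norm_nonneg _))
  -- The new curvature `h'`, not the old one, multiplies `G`: this coefficient is not small, but
  -- `h'` is already superlinear in w.
  refine ⟨(T₁ (G * val h' + iC * N₁ w), h'), ?_, ?_⟩
  · have bz : ‖T₁ (G * val h' + iC * N₁ w)‖ ≤
        ‖T₁‖ * (‖G‖ * (‖(val : C2Data θ a b →L[ℝ] _)‖ * (‖T₂‖ * (η / D * ‖w‖)))
          + ‖iC‖ * (η / D * ‖w‖)) := by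
      refine (T₁.le_opNorm _).trans (mul_le_mul_of_nonneg_left ?_ (norm_nonneg _))
      refine (norm_add_le _ _).trans (add_le_add ?_ ?_)
      · refine (norm_mul_le _ _).trans (mul_le_mul_of_nonneg_left ?_ (norm_nonneg _))
        exact (val.le_opNorm _).trans (mul_le_mul_of_nonneg_left bh (norm_nonneg _))
      · exact (norm_mul_le _ _).trans (mul_le_mul_of_nonneg_left b1 (norm_nonneg _))
    have hm : η * ‖w‖ = D * (η / D * ‖w‖) := by field_simp
    have hn : 0 ≤ η / D * ‖w‖ := mul_nonneg hc.le (norm_nonneg _)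
    rw [hm]
    refine max_le (bz.trans ?_) (bh.trans ?_)
    · have h1 : 0 ≤ ‖T₂‖ * (η / D * ‖w‖) := mul_nonneg (norm_nonneg _) hn
      rw [hD]
      linarith
    · refine mul_le_mul_of_nonneg_right ?_ hn
      rw [hD]
      linarith
  · intro φ H φ' H' hφ hH hφ' hH'
    have hψ := hφ.hasJet_mul hzχ
    have hu := hzf.hasJet.add hψ
    replace hφ' : Represents φ' ((dirichletEquiv p₁ hq₁).symm (G * val h' + iC * N₁ w, 0, 0)) := hφ'
    have hH'' : Represents H' ((dirichletEquiv 0 hq₂).symm (N₂ w, 0, 0)) := hH'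
    replace hH' : Represents H' h' := hH'
    refine ⟨uniqueDirichletSol hq₂ hL₂ (fun x => ?_) hH'',
      uniqueDirichletSol hq₁ hL₁ (fun x => ?_) hφ'⟩
    · have k0 : perturbed f χ φ x = F₀ x + (mulJet₀ zχ w.1) x := hu.eq x
      have k1 : d1 (Icc a b) (perturbed f χ φ) x = F₁ x + (mulJet₁ zχ w.1) x := hu.d1_eq x
      have k2 : d2 (Icc a b) (perturbed f χ φ) x = F₂ x + (mulJet₂ zχ w.1) x := hu.d2_eq x
      rw [e2 x, rhs2, opL2, eulerLagrange, k0, k1, k2, hH.d1_eq, hH.d2_eq, hH x, eF₀, eF₁, eF₂]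
      rfl
    · have k1 : d1 (Icc a b) (fun y => f y + φ y * χ y) x = F₁ x + (mulJet₁ zχ w.1) x :=
        hu.d1_eq x
      have k2 : d2 (Icc a b) (fun y => f y + φ y * χ y) x = F₂ x + (mulJet₂ zχ w.1) x :=
        hu.d2_eq x
      have k3 : φ x * χ x = (mulJet₀ zχ w.1) x := hψ.eq x
      rw [HolderAlg.add_apply, HolderAlg.mul_apply, HolderAlg.mul_apply, e1 x, rhs1, remainder1,
        jacobiOp, meanCurv, hψ.d1_eq, hψ.d2_eq, k1, k2, k3, hH' x, eF₀, eF₁, eF₂, eC₀, hG, hiC]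
      rfl

theorem represents_zero : Represents (fun _ => 0) (0 : C2Data θ a b) := fun x => by
  rw [map_zero]; rfl

theorem Represents.sub_zero {u : ℝ → ℝ} {z : C2Data θ a b} (h : Represents u z) :
    Represents (fun x => u x - 0) z := fun x => by
  rw [← h x]; exact _root_.sub_zero _

theorem Represents.cHolderNorm_nonneg {u : ℝ → ℝ} {z : C2Data θ a b} (h : Represents u z) :
    0 ≤ cHolderNorm 2 θ (Icc a b) u := (norm_nonneg z).trans h.norm_le_cHolderNorm

theorem cHolderNorm_zero {θ : ℝ≥0} {a b : ℝ} (k : ℕ) :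
    cHolderNorm k θ (Icc a b) (fun _ => 0) = 0 := by
  have h1 : ∀ j, iteratedDerivWithin j (fun _ : ℝ => (0 : ℝ)) (Icc a b) = fun _ => 0 := fun j => by
    funext x
    simp
  have h2 : supNorm (Icc a b) (fun _ => 0) = 0 := by
    refine le_antisymm (Real.sSup_le ?_ le_rfl) (Real.sSup_nonneg ?_)
    all_goals
      rintro r ⟨x, -, rfl⟩
      simp
  have h3 : holderSeminorm θ (Icc a b) (fun _ => 0) = 0 := by
    refine le_antisymm (Real.sSup_le ?_ le_rfl) (Real.sSup_nonneg ?_)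
    all_goals
      rintro r ⟨x, -, y, -, -, rfl⟩
      simp
  simp only [cHolderNorm, h1, h2, h3, Finset.sum_const_zero, add_zero]

end

end Nitsche

/-! ### The scheme and its limit. -/

/-- Each step of the scheme divides the norm of the pair `(φ, H)` by at least two, so the scheme
stays in the ball of radius `ε` and converges. As `f` solves the minimal surface equation, the pair
`(0, 0)` solves the coupled problem, and the limit, which the scheme determines, is this pair. -/
theorem theorem4p1 (θ : ℝ≥0) (hθ₀ : 0 < θ) (hθ₁ : θ < 1)
    (α β : ℝ) (hα : 0 < α) (hβ : 0 < β)
    (xl xr : ℝ) (hI : xl < xr)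
    (f χ : ℝ → ℝ)
    (hf : Nitsche.MemCHolder 4 θ (Icc xl xr) f)
    (hpos : ∀ x ∈ Icc xl xr, 0 < f x)
    (hmin : Nitsche.MinimalSurfaceEq (Icc xl xr) f)
    (hstable : Nitsche.IsStabilityFunction θ (Icc xl xr) f χ)
    (hcond : ∀ x ∈ Icc xl xr, 1 / f x ^ 2 < α / β) :
    ∀ δ : ℝ, 0 < δ → ∃ ε₀ : ℝ, 0 < ε₀ ∧ ∀ ε : ℝ, 0 < ε → ε ≤ ε₀ →
      ∀ φ₀ H₀ : ℝ → ℝ,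
        Nitsche.MemCHolder 2 θ (Icc xl xr) φ₀ → Nitsche.MemCHolder 2 θ (Icc xl xr) H₀ →
        Nitsche.cHolderNorm 2 θ (Icc xl xr) φ₀ < ε →
        Nitsche.cHolderNorm 2 θ (Icc xl xr) H₀ < ε →
        ∃ φ H : ℕ → ℝ → ℝ, φ 0 = φ₀ ∧ H 0 = H₀ ∧
          Nitsche.IsSuccessiveApprox θ α β xl xr f χ φ H ∧
          (∀ k, Nitsche.cHolderNorm 2 θ (Icc xl xr) (φ k) ≤ ε ∧
            Nitsche.cHolderNorm 2 θ (Icc xl xr) (H k) ≤ ε) ∧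
          ∃ φ' H' : ℝ → ℝ,
            -- the iterates converge to a solution of the coupled boundary value problems
            Nitsche.TendstoC2Holder θ (Icc xl xr) φ φ' ∧
            Nitsche.TendstoC2Holder θ (Icc xl xr) H H' ∧
            Nitsche.DirichletSol θ xl xr (Nitsche.opL1 (Icc xl xr) f χ)
              (Nitsche.rhs1 (Icc xl xr) f χ φ' H') φ' ∧
            Nitsche.DirichletSol θ xl xr (Nitsche.opL2 α β (Icc xl xr) f)
              (Nitsche.rhs2 α β (Icc xl xr) f χ φ' H') H' ∧
            Nitsche.cHolderNorm 2 θ (Icc xl xr) φ' < ε ∧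
            Nitsche.cHolderNorm 2 θ (Icc xl xr) H' < ε ∧
            -- the resulting pair solves both equations
            (∀ x ∈ Icc xl xr, 0 < Nitsche.perturbed f χ φ' x) ∧
            Nitsche.MeanCurvatureEq (Icc xl xr) (Nitsche.perturbed f χ φ') H' ∧
            Nitsche.EulerLagrangeEq α β (Icc xl xr) (Nitsche.perturbed f χ φ') H' ∧
            Nitsche.perturbed f χ φ' xl = f xl ∧ Nitsche.perturbed f χ φ' xr = f xr ∧
            H' xl = 0 ∧ H' xr = 0 ∧
            -- and is a small perturbation of the minimal surface
            Nitsche.MemCHolder 4 θ (Icc xl xr) (Nitsche.perturbed f χ φ') ∧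
            Nitsche.cHolderNorm 4 θ (Icc xl xr)
              (fun x => Nitsche.perturbed f χ φ' x - f x) < δ := by

  have : Fact (xl < xr) := ⟨hI⟩
  have : Fact (θ ≤ 1) := ⟨hθ₁.le⟩
  intro δ hδ
  obtain ⟨zf, hzf⟩ := Nitsche.exists_represents_of_contDiffOn (θ := θ)
    (hf.1.of_le (m := 3) (by norm_num))
  obtain ⟨zχ, hzχ⟩ := Nitsche.exists_represents hstable.1
  obtain ⟨K, hK, hnorm⟩ := Nitsche.exists_cHolderNorm_le θ xl xr
  obtain ⟨ε₀, hε₀, hstep⟩ := Metric.eventually_nhds_iff_ball.1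
    (Nitsche.exists_approximation_step hzf hzχ hpos hmin hstable.2.1 hstable.2.2 hcond
      -- The factor 1/2 halves the data norm at each step; 1/(2K) absorbs the constant of the norm
      -- comparison, so that the Hölder norms of the iterates are also at most ε.
      (η := min (1 / 2) (1 / (2 * K))) (by positivity))
  choose! F hF hFsol using hstep
  have hη₁ : min (1 / 2) (1 / (2 * K)) ≤ 1 / 2 := min_le_left _ _
  have hη₂ : K * min (1 / 2) (1 / (2 * K)) ≤ 1 / 2 := by
    refine (mul_le_mul_of_nonneg_left (min_le_right _ _) hK.le).trans_eq ?_
    field_simp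
  refine ⟨ε₀, hε₀, fun ε hε hεε₀ φ₀ H₀ hφ₀ hH₀ hφ₀ε hH₀ε => ?_⟩
  obtain ⟨z₀, hz₀⟩ := Nitsche.exists_represents hφ₀
  obtain ⟨h₀, hh₀⟩ := Nitsche.exists_represents hH₀
  let w : ℕ → Nitsche.C2Data θ xl xr × Nitsche.C2Data θ xl xr := fun k => F^[k] (z₀, h₀)
  have hw : ∀ k, w (k + 1) = F (w k) := fun k => Function.iterate_succ_apply' F k _
  have hw₀ : ‖w 0‖ < ε := max_lt (hz₀.norm_le_cHolderNorm.trans_lt hφ₀ε)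
    (hh₀.norm_le_cHolderNorm.trans_lt hH₀ε)
  have hwk : ∀ k, ‖w k‖ ≤ ε * (1 / 2) ^ k ∧ ‖w k‖ < ε₀ := by
    intro k
    induction k with
    | zero => exact ⟨by simpa using hw₀.le, hw₀.trans_le hεε₀⟩
    | succ k ih =>
      have h1 := hF (w k) (by simpa using ih.2)
      rw [← hw] at h1
      have h2 : ‖w (k + 1)‖ ≤ 1 / 2 * ‖w k‖ :=
        h1.trans (mul_le_mul_of_nonneg_right hη₁ (norm_nonneg _))
      constructor
      · rw [pow_succ]; linarith [ih.1]
      · linarith [ih.2, norm_nonneg (w k)]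
  have hKw : ∀ k, K * ‖w (k + 1)‖ ≤ ε * (1 / 2) ^ (k + 1) := by
    intro k
    have h1 := hF (w k) (by simpa using (hwk k).2)
    rw [← hw] at h1
    calc K * ‖w (k + 1)‖ ≤ K * (min (1 / 2) (1 / (2 * K)) * ‖w k‖) :=
          mul_le_mul_of_nonneg_left h1 hK.le
      _ = K * min (1 / 2) (1 / (2 * K)) * ‖w k‖ := by ring
      _ ≤ 1 / 2 * (ε * (1 / 2) ^ k) :=
          mul_le_mul hη₂ (hwk k).1 (norm_nonneg _) (by norm_num)
      _ = _ := by ring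
  -- The initial iterate has to be the given function on the whole line, which may differ outside
  -- the interval from the extension of its data.
  let φ : ℕ → ℝ → ℝ := fun k => if k = 0 then φ₀ else (Nitsche.C2Data.val (w k).1).extend
  let H : ℕ → ℝ → ℝ := fun k => if k = 0 then H₀ else (Nitsche.C2Data.val (w k).2).extend
  have hφ : ∀ k, Nitsche.Represents (φ k) (w k).1 := by
    rintro (_ | k)
    · exact hz₀
    · exact Nitsche.represents_extend _
  have hH : ∀ k, Nitsche.Represents (H k) (w k).2 := by
    rintro (_ | k)
    · exact hh₀
    · exact Nitsche.represents_extend _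
  have hφn : ∀ k, Nitsche.cHolderNorm 2 θ (Icc xl xr) (φ (k + 1)) ≤ ε * (1 / 2) ^ (k + 1) :=
    fun k => (hnorm _ _ (hφ (k + 1))).trans
      ((mul_le_mul_of_nonneg_left (norm_fst_le _) hK.le).trans (hKw k))
  have hHn : ∀ k, Nitsche.cHolderNorm 2 θ (Icc xl xr) (H (k + 1)) ≤ ε * (1 / 2) ^ (k + 1) :=
    fun k => (hnorm _ _ (hH (k + 1))).trans
      ((mul_le_mul_of_nonneg_left (norm_snd_le _) hK.le).trans (hKw k))
  have hle : ∀ k : ℕ, ε * (1 / 2 : ℝ) ^ (k + 1) ≤ ε := fun k =>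
    mul_le_of_le_one_right hε.le (pow_le_one₀ (by norm_num) (by norm_num))
  have hlim : Tendsto (fun k : ℕ => ε * (1 / 2 : ℝ) ^ (k + 1)) atTop (𝓝 0) := by
    have h1 := (tendsto_pow_atTop_nhds_zero_of_lt_one (r := (1 / 2 : ℝ)) (by norm_num)
      (by norm_num)).const_mul ε
    rw [mul_zero] at h1
    exact (tendsto_add_atTop_iff_nat 1).2 h1
  -- The step at the pair (0, 0) returns (0, 0), as its norm is at most η · 0; its solution property
  -- then says that the limit solves the coupled problem.
  have hzero := hFsol 0 (by simpa using hε₀) (fun _ => 0) (fun _ => 0) (fun _ => 0) (fun _ => 0)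
    Nitsche.represents_zero Nitsche.represents_zero
  have hF0 : F 0 = 0 := by
    have h1 := hF 0 (by simpa using hε₀)
    rwa [norm_zero, mul_zero, norm_le_zero_iff] at h1
  rw [hF0] at hzero
  obtain ⟨hzeroH, hzeroφ⟩ := hzero Nitsche.represents_zero Nitsche.represents_zero
  have hpert : Nitsche.perturbed f χ (fun _ => 0) = f := by
    funext x
    simp [Nitsche.perturbed]
  have hd1 : ∀ x ∈ Icc xl xr, Nitsche.d1 (Icc xl xr) (fun _ => 0) x = 0 := fun x hx => by
    rw [(Nitsche.represents_zero (θ := θ)).d1_eq ⟨x, hx⟩, map_zero]; rfl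
  have hd2 : ∀ x ∈ Icc xl xr, Nitsche.d2 (Icc xl xr) (fun _ => 0) x = 0 := fun x hx => by
    rw [(Nitsche.represents_zero (θ := θ)).d2_eq ⟨x, hx⟩, map_zero]; rfl
  refine ⟨φ, H, rfl, rfl, fun k => ?_, fun k => ?_, fun _ => 0, fun _ => 0, ?_, ?_, hzeroφ.1,
    hzeroH.1, ?_, ?_, ?_, ?_, ?_, ?_, ?_, rfl, rfl, ?_, ?_⟩
  · have h1 := hFsol (w k) (by simpa using (hwk k).2) (φ k) (H k) (φ (k + 1)) (H (k + 1))
      (hφ k) (hH k)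
    rw [← hw] at h1
    exact h1 (hφ (k + 1)) (hH (k + 1))
  · cases k with
    | zero => exact ⟨hφ₀ε.le, hH₀ε.le⟩
    | succ k => exact ⟨(hφn k).trans (hle k), (hHn k).trans (hle k)⟩
  · refine (tendsto_add_atTop_iff_nat 1).1 (squeeze_zero
      (fun k => (hφ (k + 1)).sub_zero.cHolderNorm_nonneg) (fun k => ?_) hlim)
    simpa only [sub_zero] using hφn k
  · refine (tendsto_add_atTop_iff_nat 1).1 (squeeze_zero
      (fun k => (hH (k + 1)).sub_zero.cHolderNorm_nonneg) (fun k => ?_) hlim)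
    simpa only [sub_zero] using hHn k
  · rwa [Nitsche.cHolderNorm_zero]
  · rwa [Nitsche.cHolderNorm_zero]
  · rwa [hpert]
  · intro x hx
    rw [hpert]
    have h1 := hmin x hx
    have h2 := (hpos x hx).ne'
    simp only [mul_zero, zero_mul, zero_add]
    rw [← h1]
    field_simp
  · intro x hx
    simp only [Nitsche.eulerLagrange, hd1 x hx, hd2 x hx]
    ring
  · rw [hpert]
  · rw [hpert]
  · rwa [hpert]
  · simp only [hpert, sub_self]
    rwa [Nitsche.cHolderNorm_zero]
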